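/- Let $n\in\mathbb{N}$ and let $\mathcal{S}_0(\mathbb{R}^n)$ be the closed subspace of the Schwartz space $\mathcal{S}(\mathbb{R}^n)$ (complex-valued functions) consisting of those $\eta$ with $\int_{\mathbb{R}^n}t^m\eta(t)\,dt=0$ for every multi-index $m\in\mathbb{N}^n$. Let $X$ be a Hausdorff locally convex (complex) topological vector space, and let $E$ be a complex Banach space, with norm $\|\cdot\|$, that is a linear subspace of $X$ with continuous inclusion $E\hookrightarrow X$. For $Y\in\{E,X\}$ let $\mathcal{S}'_0(\mathbb{R}^n,Y)$ be the space of continuous linear maps $\mathcal{S}_0(\mathbb{R}^n)\to Y$; via the inclusion, $\mathcal{S}'_0(\mathbb{R}^n,E)\subseteq\mathcal{S}'_0(\mathbb{R}^n,X)$. Let $\mathbf{f}\in\mathcal{S}'_0(\mathbb{R}^n,X)$ and let $\psi\in\mathcal{S}_0(\mathbb{R}^n)$ be non-degenerate, i.e. its Fourier transform $\hat\psi(u)=\int_{\mathbb{R}^n}\psi(t)e^{-iu\cdot t}\,dt$ does not vanish identically on any ray $\{r\omega:r>0\}$, $|\omega|=1$. Let $$\mathcal{W}_\psi\mathbf{f}(x,y)=\langle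 \mathbf{f}(x+yt),\overline{\psi}(t)\rangle=\Big\langle \mathbf{f}(t),\frac1{y^n}\overline{\psi}\Big(\frac{t-x}{y}\Big)\Big\rangle\in X,\qquad (x,y)\in\mathbb{R}^n\times(0,\infty),$$ be the wavelet transform of $\mathbf{f}$. Then $\mathbf{f}\in\mathcal{S}'_0(\mathbb{R}^n,E)$ if and only if the following two conditions hold: 1. $\mathcal{W}_\psi\mathbf{f}(x,y)\in E$ for almost every $(x,y)\in\mathbb{R}^n\times(0,\infty)$, and $\mathcal{W}_\psi\mathbf{f}$ is (Bochner) measurable as an $E$-valued function; 2. there are $k,l\in\mathbb{N}$ such that $$\int_0^\infty\int_{\mathbb{R}^n}\Big(\frac1y+y\Big)^{-k}(1+|x|)^{-l}\,\|\mathcal{W}_\psi\mathbf{f}(x,y)\|\,dx\,dy<\infty .$$ -/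

import Mathlib

open MeasureTheory
open scoped SchwartzMap ComplexConjugate

noncomputable section

namespace Lizorkin

/-- The monomial `t ^ m = t₁ ^ m₁ ⋯ tₙ ^ mₙ`. -/
def monomial {n : ℕ} (m : Fin n → ℕ) (t : EuclideanSpace ℝ (Fin n)) : ℝ :=
  ∏ i, t i ^ m i

theorem integrable_monomial_mul {n : ℕ} (m : Fin n → ℕ)
    (η : 𝓢(EuclideanSpace ℝ (Fin n), ℂ)) :
    Integrable (fun t => (monomial m t : ℂ) * η t) := by
  refine (η.integrable_pow_mul volume (∑ i, m i)).mono' ?_ (.of_forall fun t => ?_)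
  · refine Continuous.aestronglyMeasurable ?_
    unfold monomial
    have := η.continuous
    fun_prop
  · rw [norm_mul, Complex.norm_real, monomial, norm_prod, ← Finset.prod_pow_eq_pow_sum]
    gcongr with i
    rw [norm_pow]
    gcongr
    exact PiLp.norm_apply_le t i

/-- The Lizorkin space `𝓢₀(ℝⁿ)` of Schwartz functions all of whose moments vanish. As a submodule
of `𝓢(ℝⁿ)` it carries the subspace topology. -/
def testSpace (n : ℕ) : Submodule ℂ 𝓢(EuclideanSpace ℝ (Fin n), ℂ) where
  carrier := {η | ∀ m : Fin n → ℕ, ∫ t, (monomial m t : ℂ) * η t = 0}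
  zero_mem' := by simp
  add_mem' := by
    intro a b ha hb m
    simp only [_root_.add_apply, mul_add]
    rw [integral_add (integrable_monomial_mul m a) (integrable_monomial_mul m b), ha m, hb m,
      add_zero]
  smul_mem' := by
    intro c a ha m
    simp only [_root_.smul_apply, smul_eq_mul, mul_left_comm _ c]
    rw [integral_const_mul, ha m, mul_zero]

/-- `𝓢'₀(ℝⁿ, X)`: continuous linear maps from `𝓢₀(ℝⁿ)` to `X`. -/
abbrev Distribution (n : ℕ) (X : Type*) [AddCommGroup X] [Module ℂ X] [TopologicalSpace X] :=
  testSpace n →L[ℂ] X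

/-- The Fourier transform `φ̂(u) = ∫ φ(t) exp(-i u · t) dt`. -/
def fourierHat {n : ℕ} (φ : 𝓢(EuclideanSpace ℝ (Fin n), ℂ)) (u : EuclideanSpace ℝ (Fin n)) : ℂ :=
  ∫ t, φ t * Complex.exp (-Complex.I * (inner ℝ u t : ℝ))

/-- A test function is non-degenerate if its Fourier transform does not vanish identically on any
ray `{r ω : r > 0}`, `|ω| = 1`, through the origin. -/
def NonDegenerate {n : ℕ} (φ : 𝓢(EuclideanSpace ℝ (Fin n), ℂ)) : Prop :=
  ∀ ω : EuclideanSpace ℝ (Fin n), ‖ω‖ = 1 → ∃ r : ℝ, 0 < r ∧ fourierHat φ (r • ω) ≠ 0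

/-- The Schwartz function `t ↦ y⁻ⁿ conj (ψ ((t - x) / y))`. -/
def atomSchwartz {n : ℕ} (ψ : 𝓢(EuclideanSpace ℝ (Fin n), ℂ)) (x : EuclideanSpace ℝ (Fin n))
    (y : ℝ) (hy : 0 < y) : 𝓢(EuclideanSpace ℝ (Fin n), ℂ) :=
  (y ^ n)⁻¹ • SchwartzMap.compSubConstCLM ℝ x
    (SchwartzMap.compCLMOfContinuousLinearEquiv ℝ
      (ContinuousLinearEquiv.smulLeft (Units.mk0 y⁻¹ (inv_ne_zero hy.ne')))
      (SchwartzMap.postcompCLM (𝕜 := ℝ) (Complex.conjCLE : ℂ →L[ℝ] ℂ) ψ))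

theorem atomSchwartz_apply {n : ℕ} (ψ : 𝓢(EuclideanSpace ℝ (Fin n), ℂ))
    (x : EuclideanSpace ℝ (Fin n)) (y : ℝ) (hy : 0 < y) (t : EuclideanSpace ℝ (Fin n)) :
    atomSchwartz ψ x y hy t = (((y ^ n)⁻¹ : ℝ) : ℂ) * conj (ψ (y⁻¹ • (t - x))) := by
  simp [atomSchwartz]

theorem integral_eval_mul_eq_zero {n : ℕ} {η : 𝓢(EuclideanSpace ℝ (Fin n), ℂ)}
    (hη : η ∈ testSpace n) (p : MvPolynomial (Fin n) ℝ) :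
    ∫ t, ((MvPolynomial.eval (fun i => t i) p : ℝ) : ℂ) * η t = 0 := by
  have h : ∀ t : EuclideanSpace ℝ (Fin n), ((MvPolynomial.eval (fun i => t i) p : ℝ) : ℂ) * η t =
      ∑ d ∈ p.support, ((p.coeff d : ℝ) : ℂ) * ((monomial (fun i => d i) t : ℂ) * η t) := by
    intro t
    rw [MvPolynomial.eval_eq', Complex.ofReal_sum, Finset.sum_mul]
    refine Finset.sum_congr rfl fun d _ => ?_
    rw [monomial, Complex.ofReal_mul, mul_assoc]
  simp_rw [h]
  rw [integral_finsetSum _ fun d _ => (integrable_monomial_mul (fun i => d i) η).const_mul _]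
  refine Finset.sum_eq_zero fun d _ => ?_
  rw [integral_const_mul, hη (fun i => d i), mul_zero]

theorem atomSchwartz_mem {n : ℕ} {ψ : 𝓢(EuclideanSpace ℝ (Fin n), ℂ)} (hψ : ψ ∈ testSpace n)
    (x : EuclideanSpace ℝ (Fin n)) (y : ℝ) (hy : 0 < y) :
    atomSchwartz ψ x y hy ∈ testSpace n := by
  intro m
  let p : MvPolynomial (Fin n) ℝ :=
    ∏ i, (MvPolynomial.C (x i) + MvPolynomial.C y * MvPolynomial.X i) ^ m i
  have hp : ∀ s : EuclideanSpace ℝ (Fin n),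
      MvPolynomial.eval (fun i => s i) p = monomial m (x + y • s) := by
    intro s
    simp [p, monomial, map_prod]
  let G : EuclideanSpace ℝ (Fin n) → ℂ := fun s =>
    (((y ^ n)⁻¹ : ℝ) : ℂ) * conj (((MvPolynomial.eval (fun i => s i) p : ℝ) : ℂ) * ψ s)
  have hG : ∀ t : EuclideanSpace ℝ (Fin n),
      (monomial m t : ℂ) * atomSchwartz ψ x y hy t = G (y⁻¹ • (t - x)) := by
    intro t
    have : x + y • y⁻¹ • (t - x) = t := by
      rw [smul_inv_smul₀ hy.ne']; abel
    simp only [G, hp, this, atomSchwartz_apply, map_mul, Complex.conj_ofReal]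
    ring
  simp_rw [hG]
  rw [integral_sub_right_eq_self (fun t => G (y⁻¹ • t)) x, Measure.integral_comp_inv_smul,
    integral_const_mul, integral_conj, integral_eval_mul_eq_zero hψ p]
  simp

/-- The wavelet atom `t ↦ y⁻ⁿ conj (ψ ((t - x) / y))` as an element of `𝓢₀(ℝⁿ)`. -/
def atom {n : ℕ} (ψ : testSpace n) (x : EuclideanSpace ℝ (Fin n)) (y : ℝ) (hy : 0 < y) :
    testSpace n :=
  ⟨atomSchwartz ψ.1 x y hy, atomSchwartz_mem ψ.2 x y hy⟩

/-- The upper half-space `ℝⁿ × (0, ∞)`. -/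
def upperHalfSpace (n : ℕ) : Set (EuclideanSpace ℝ (Fin n) × ℝ) :=
  {p | 0 < p.2}

open Classical in
/-- The wavelet transform
`W_ψ f (x, y) = ⟨f (x + y t), conj (ψ t)⟩ = ⟨f t, y⁻ⁿ conj (ψ ((t - x) / y))⟩` for `y > 0`
(with the value `0` outside the upper half-space). -/
def waveletTransform {n : ℕ} {X : Type*} [AddCommGroup X] [Module ℂ X] [TopologicalSpace X]
    (ψ : testSpace n) (f : Distribution n X) (p : EuclideanSpace ℝ (Fin n) × ℝ) : X :=
  if hy : 0 < p.2 then f (atom ψ p.1 p.2 hy) else 0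

end Lizorkin

end

/-!
The forward implication is a growth estimate. The atoms `t ↦ y⁻ⁿ conj (ψ ((t - x) / y))` depend
continuously on `(x, y)` in the topology of `𝓢₀(ℝⁿ)` (`continuousOn_atomAt`), and their Schwartz
seminorms are bounded by powers of `1 / y + y` and `1 + |x|` (`exists_seminorm_atomSchwartz_le`), so
applying a Banach-valued distribution to them gives a continuous function of polynomial growth.

For the converse, non-degeneracy yields a reconstruction wavelet `η ∈ 𝓢₀(ℝⁿ)`
(`exists_reconstruction_wavelet`). Its Fourier transform is `ψ̂ χ / c`, where `χ` is a cut-off to an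
annulus that meets the set `ψ̂ ≠ 0` on every ray (it exists because the sphere is compact), and `c`
is the integral of `|ψ̂|² χ` along rays for the measure `dy / y`. As `c` is invariant under
dilations, the Calderón identity `∫ conj (ψ̂ (y ξ)) η̂ (y ξ) dy / y = 1` holds for `ξ ≠ 0`.

With the kernel `K_φ (x, y) = ∫ φ (x + y t) η t dt`, which decays rapidly in the upper half-space
because all moments of both `φ` and `η` vanish (`exists_norm_kernel_le`), the integral
`g φ = ∫∫ y⁻¹ K_φ (x, y) F (x, y) dx dy` converges in `E` and defines a distribution
(`exists_synthesis`). It remains to identify `g` with `f`. Since `X` is Hausdorff and locally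
convex, it suffices to apply continuous functionals, which reduces the claim to the scalar
reproducing formula `u φ = ∫∫ y⁻¹ K_φ (x, y) u (atom (x, y)) dx dy` for `u ∈ 𝓢₀'(ℝⁿ)`
(`reproducing_formula`).

The point of that formula is to exchange `u` with the integral, although the Schwartz space is not
normed. As `u` is bounded by finitely many Schwartz seminorms, the Hahn–Banach theorem factors it
through a finite product of spaces of bounded continuous functions, by means of the maps
`φ ↦ |t| ^ k D ^ m φ`. The integral makes sense there as a Bochner integral, and it can be computed
pointwise: by Fourier inversion `D ^ m φ t` is the integral of `𝓕⁻ φ` against a function of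
polynomial growth, and for such functionals the formula follows from Fubini's theorem and the
Calderón identity (`reproducing_of_fourierInv`).
-/

noncomputable section

namespace Lizorkin

open Filter Topology Set
open scoped FourierTransform LineDeriv ContDiff BoundedContinuousFunction

/-! ### Dilated and translated test functions -/

/-- The pointwise complex conjugate of a Schwartz function. -/
def conjSchwartz {n : ℕ} (ψ : 𝓢(EuclideanSpace ℝ (Fin n), ℂ)) :
    𝓢(EuclideanSpace ℝ (Fin n), ℂ) :=
  SchwartzMap.postcompCLM (𝕜 := ℝ) (Complex.conjCLE : ℂ →L[ℝ] ℂ) ψ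

@[simp]
theorem conjSchwartz_apply {n : ℕ} (ψ : 𝓢(EuclideanSpace ℝ (Fin n), ℂ))
    (t : EuclideanSpace ℝ (Fin n)) : conjSchwartz ψ t = conj (ψ t) := by
  simp [conjSchwartz]

theorem iteratedFDeriv_atomSchwartz {n : ℕ} (ψ : 𝓢(EuclideanSpace ℝ (Fin n), ℂ))
    (x : EuclideanSpace ℝ (Fin n)) (y : ℝ) (hy : 0 < y) (m : ℕ) (t : EuclideanSpace ℝ (Fin n)) :
    iteratedFDeriv ℝ m (atomSchwartz ψ x y hy) t =
      ((y ^ n)⁻¹ * y⁻¹ ^ m) • iteratedFDeriv ℝ m (conjSchwartz ψ) (y⁻¹ • (t - x)) := by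
  have h : ⇑(atomSchwartz ψ x y hy) =
      fun t => (y ^ n)⁻¹ • (fun s => conjSchwartz ψ (y⁻¹ • s)) (t - x) := by
    ext t
    simp only [atomSchwartz_apply, conjSchwartz_apply, Complex.real_smul]
  have hs : ContDiff ℝ m (fun s => conjSchwartz ψ (y⁻¹ • s)) :=
    ((conjSchwartz ψ).smooth m).comp (contDiff_const_smul _)
  have hs' : ContDiff ℝ m (fun t => (fun s => conjSchwartz ψ (y⁻¹ • s)) (t - x)) :=
    hs.comp (contDiff_id.sub contDiff_const)
  rw [h, iteratedFDeriv_const_smul_apply' hs'.contDiffAt,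
    iteratedFDeriv_comp_sub' (f := fun s => conjSchwartz ψ (y⁻¹ • s)) m x,
    iteratedFDeriv_comp_const_smul _ ((conjSchwartz ψ).smooth m), smul_smul]

theorem norm_iteratedFDeriv_atomSchwartz {n : ℕ} (ψ : 𝓢(EuclideanSpace ℝ (Fin n), ℂ))
    (x : EuclideanSpace ℝ (Fin n)) (y : ℝ) (hy : 0 < y) (m : ℕ) (t : EuclideanSpace ℝ (Fin n)) :
    ‖iteratedFDeriv ℝ m (atomSchwartz ψ x y hy) t‖ =
      (y⁻¹) ^ (n + m) * ‖iteratedFDeriv ℝ m (conjSchwartz ψ) (y⁻¹ • (t - x))‖ := by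
  rw [iteratedFDeriv_atomSchwartz, norm_smul, Real.norm_of_nonneg (by positivity), pow_add,
    inv_pow y n]

theorem one_le_inv_add {y : ℝ} (hy : 0 < y) : 1 ≤ 1 / y + y := by
  rw [div_add' _ _ _ hy.ne', le_div_iff₀ hy]
  nlinarith [sq_nonneg (y - 1)]

/-- The Schwartz seminorms of the atoms grow at most polynomially in the position, the scale and
the inverse scale. -/
theorem exists_seminorm_atomSchwartz_le {n : ℕ} (ψ : 𝓢(EuclideanSpace ℝ (Fin n), ℂ)) (k m : ℕ) :
    ∃ C : ℝ, 0 ≤ C ∧ ∀ (x : EuclideanSpace ℝ (Fin n)) (y : ℝ) (hy : 0 < y),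
      SchwartzMap.seminorm ℂ k m (atomSchwartz ψ x y hy) ≤
        C * (1 / y + y) ^ (n + m + k) * (1 + ‖x‖) ^ k := by
  set S := 2 ^ k * (Finset.Iic (k, m)).sup (fun m => SchwartzMap.seminorm ℂ m.1 m.2)
    (conjSchwartz ψ) with hS
  have hS0 : 0 ≤ S := by positivity
  refine ⟨2 ^ k * S, by positivity, fun x y hy => ?_⟩
  refine SchwartzMap.seminorm_le_bound ℂ k m _ (by positivity) fun t => ?_
  set s := y⁻¹ • (t - x) with hs
  have ht : t = x + y • s := by rw [hs, smul_inv_smul₀ hy.ne']; abel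
  have h1 : ‖t‖ ≤ (2 * (1 / y + y)) * (1 + ‖x‖) * (1 + ‖s‖) := by
    have h2 : ‖t‖ ≤ ‖x‖ + y * ‖s‖ := by
      rw [ht]
      refine (norm_add_le _ _).trans ?_
      rw [norm_smul, Real.norm_of_nonneg hy.le]
    have h3 := one_le_inv_add hy
    have h4 : y ≤ 1 / y + y := by have : 0 < 1 / y := by positivity
                                  linarith
    calc ‖t‖ ≤ ‖x‖ + y * ‖s‖ := h2
      _ ≤ (1 / y + y) * ‖x‖ + (1 / y + y) * ‖s‖ := by
          gcongr
          exact le_mul_of_one_le_left (norm_nonneg _) h3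
      _ ≤ _ := by
          have : 0 ≤ (1 / y + y) * (2 + ‖x‖ + ‖s‖ + 2 * (‖x‖ * ‖s‖)) := by positivity
          nlinarith
  have h5 : y⁻¹ ≤ 1 / y + y := by rw [one_div]; linarith
  have h6 := SchwartzMap.one_add_le_sup_seminorm_apply (𝕜 := ℂ) (m := (k, m)) le_rfl le_rfl
    (conjSchwartz ψ) s
  rw [norm_iteratedFDeriv_atomSchwartz, ← hs]
  calc ‖t‖ ^ k * (y⁻¹ ^ (n + m) * ‖iteratedFDeriv ℝ m (conjSchwartz ψ) s‖)
      ≤ ((2 * (1 / y + y)) * (1 + ‖x‖) * (1 + ‖s‖)) ^ k *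
        ((1 / y + y) ^ (n + m) * ‖iteratedFDeriv ℝ m (conjSchwartz ψ) s‖) := by gcongr
    _ = 2 ^ k * (1 / y + y) ^ (n + m + k) * (1 + ‖x‖) ^ k *
        ((1 + ‖s‖) ^ k * ‖iteratedFDeriv ℝ m (conjSchwartz ψ) s‖) := by
          rw [mul_pow, mul_pow, mul_pow, pow_add _ (n + m) k]; ring
    _ ≤ 2 ^ k * (1 / y + y) ^ (n + m + k) * (1 + ‖x‖) ^ k * S := by gcongr
    _ = _ := by ring

open Classical in
/-- The wavelet atom at the point `p` of the upper half-space, extended by zero to all points. -/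
def atomAt {n : ℕ} (ψ : testSpace n) (p : EuclideanSpace ℝ (Fin n) × ℝ) : testSpace n :=
  if hy : 0 < p.2 then atom ψ p.1 p.2 hy else 0

theorem atomAt_of_pos {n : ℕ} (ψ : testSpace n) {p : EuclideanSpace ℝ (Fin n) × ℝ}
    (hp : 0 < p.2) : atomAt ψ p = atom ψ p.1 p.2 hp := dif_pos hp

theorem waveletTransform_eq {n : ℕ} {X : Type*} [AddCommGroup X] [Module ℂ X] [TopologicalSpace X]
    (ψ : testSpace n) (f : Distribution n X) (p : EuclideanSpace ℝ (Fin n) × ℝ) :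
    waveletTransform ψ f p = f (atomAt ψ p) := by
  unfold waveletTransform atomAt
  split_ifs <;> simp

/-- The atoms depend continuously on the point, in every Schwartz seminorm: for large arguments this
follows from the bound on a seminorm with one more weight, on compact sets from joint continuity. -/
theorem eventually_seminorm_atomAt_sub_le {n : ℕ} (ψ : testSpace n) (k m : ℕ)
    {q : EuclideanSpace ℝ (Fin n) × ℝ} (hq : 0 < q.2) {ε : ℝ} (hε : 0 < ε) :
    ∀ᶠ p in 𝓝 q, SchwartzMap.seminorm ℂ k m
      ((atomAt ψ p).1 - (atomAt ψ q).1) ≤ ε := by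
  obtain ⟨C, hC0, hC⟩ := exists_seminorm_atomSchwartz_le ψ.1 (k + 1) m
  have hpos : ∀ᶠ p in 𝓝 q, 0 < p.2 := continuousAt_snd.eventually_const_lt hq
  -- The seminorms with one more weight are bounded near `q`, which controls large arguments.
  let b : EuclideanSpace ℝ (Fin n) × ℝ → ℝ :=
    fun p => C * (1 / p.2 + p.2) ^ (n + m + (k + 1)) * (1 + ‖p.1‖) ^ (k + 1)
  have hb : ContinuousAt b q := by
    have : ContinuousAt (fun p : EuclideanSpace ℝ (Fin n) × ℝ => 1 / p.2) q :=
      continuousAt_const.div continuousAt_snd hq.ne'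
    exact ((this.add continuousAt_snd).pow _).const_mul C |>.mul (by fun_prop)
  set M := b q + 1 with hM
  have hbM : ∀ᶠ p in 𝓝 q, b p ≤ M := (hb.eventually_lt_const (lt_add_one _)).mono fun _ => le_of_lt
  have hM0 : 0 < M := by
    have : 0 ≤ b q := by simp only [b]; positivity
    linarith
  have hfar : ∀ p : EuclideanSpace ℝ (Fin n) × ℝ, 0 < p.2 → b p ≤ M → ∀ t,
      ‖t‖ * (‖t‖ ^ k * ‖iteratedFDeriv ℝ m (atomAt ψ p).1 t‖) ≤ M := by
    intro p hp hbp t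
    rw [atomAt_of_pos ψ hp]
    refine le_trans ?_ (((SchwartzMap.le_seminorm ℂ (k + 1) m _ t).trans (hC p.1 p.2 hp)).trans hbp)
    rw [pow_succ']
    exact (mul_assoc _ _ _).ge
  let G : EuclideanSpace ℝ (Fin n) × ℝ → EuclideanSpace ℝ (Fin n) → _ := fun p t =>
    (‖t‖ ^ k * ((p.2 ^ n)⁻¹ * p.2⁻¹ ^ m)) •
      iteratedFDeriv ℝ m (conjSchwartz ψ.1) (p.2⁻¹ • (t - p.1))
  have hG : ∀ t, ContinuousAt (fun z : (EuclideanSpace ℝ (Fin n) × ℝ) × EuclideanSpace ℝ (Fin n) =>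
      G z.1 z.2) (q, t) := by
    intro t
    have h1 : ContinuousAt (fun z : (EuclideanSpace ℝ (Fin n) × ℝ) × EuclideanSpace ℝ (Fin n) =>
      z.1.2⁻¹) (q, t) := ContinuousAt.inv₀ (by fun_prop) hq.ne'
    have h2 : Continuous (iteratedFDeriv ℝ m (conjSchwartz ψ.1)) :=
      ((conjSchwartz ψ.1).smooth m).continuous_iteratedFDeriv'
    have h3 : ContinuousAt (fun z : (EuclideanSpace ℝ (Fin n) × ℝ) × EuclideanSpace ℝ (Fin n) =>
      z.2 - z.1.1) (q, t) := by fun_prop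
    have h4 : ContinuousAt (fun z : (EuclideanSpace ℝ (Fin n) × ℝ) × EuclideanSpace ℝ (Fin n) =>
      ‖z.2‖ ^ k) (q, t) := by fun_prop
    have h5 : ContinuousAt (fun z : (EuclideanSpace ℝ (Fin n) × ℝ) × EuclideanSpace ℝ (Fin n) =>
        ‖z.2‖ ^ k * ((z.1.2 ^ n)⁻¹ * z.1.2⁻¹ ^ m)) (q, t) := by
      simp_rw [← inv_pow]
      exact h4.mul ((h1.pow n).mul (h1.pow m))
    have h6 : ContinuousAt (fun z : (EuclideanSpace ℝ (Fin n) × ℝ) × EuclideanSpace ℝ (Fin n) =>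
        iteratedFDeriv ℝ m (conjSchwartz ψ.1) (z.1.2⁻¹ • (z.2 - z.1.1))) (q, t) :=
      ContinuousAt.comp (g := iteratedFDeriv ℝ m (conjSchwartz ψ.1)) h2.continuousAt (h1.smul h3)
    exact h5.smul h6
  have hGq : ∀ t, ContinuousAt (fun z : (EuclideanSpace ℝ (Fin n) × ℝ) ×
      EuclideanSpace ℝ (Fin n) => G q z.2) (q, t) := fun t =>
    ContinuousAt.comp (f := fun z : (EuclideanSpace ℝ (Fin n) × ℝ) × EuclideanSpace ℝ (Fin n) =>
      (q, z.2)) (x := (q, t)) (hG t) (by fun_prop)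
  have hGeq : ∀ p : EuclideanSpace ℝ (Fin n) × ℝ, 0 < p.2 → ∀ t,
      ‖t‖ ^ k • iteratedFDeriv ℝ m (atomAt ψ p).1 t = G p t := by
    intro p hp t
    rw [atomAt_of_pos ψ hp]
    change ‖t‖ ^ k • iteratedFDeriv ℝ m (atomSchwartz ψ.1 p.1 p.2 hp) t = _
    rw [iteratedFDeriv_atomSchwartz, smul_smul]
  have hnear : ∀ᶠ p in 𝓝 q, ∀ t ∈ Metric.closedBall (0 : EuclideanSpace ℝ (Fin n)) (2 * M / ε),
      dist (G p t) (G q t) < ε := by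
    refine (isCompact_closedBall _ _).eventually_forall_of_forall_eventually fun t _ => ?_
    have h1 : ContinuousAt (fun z : (EuclideanSpace ℝ (Fin n) × ℝ) × EuclideanSpace ℝ (Fin n) =>
        dist (G z.1 z.2) (G q z.2)) (q, t) :=
      (hG t).dist (hGq t)
    exact h1.eventually_lt_const (by simpa using hε)
  filter_upwards [hpos, hbM, hnear] with p hp hbp hpn
  refine SchwartzMap.seminorm_le_bound ℂ k m _ hε.le fun t => ?_
  have hsub : iteratedFDeriv ℝ m
      ((atomAt ψ p).1 - (atomAt ψ q).1) t =
      iteratedFDeriv ℝ m (atomAt ψ p).1 t - iteratedFDeriv ℝ m (atomAt ψ q).1 t :=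
    iteratedFDeriv_sub_apply ((atomAt ψ p).1.contDiffAt m) ((atomAt ψ q).1.contDiffAt m)
  rw [hsub]
  by_cases ht : t ∈ Metric.closedBall (0 : EuclideanSpace ℝ (Fin n)) (2 * M / ε)
  · have := hpn t ht
    rw [dist_eq_norm, ← hGeq p hp, ← hGeq q hq, ← smul_sub, norm_smul, norm_pow, norm_norm] at this
    exact this.le
  · rw [mem_closedBall_zero_iff, not_le, div_lt_iff₀ hε] at ht
    have ht0 : 0 < ‖t‖ := by
      by_contra h
      have : ‖t‖ = 0 := le_antisymm (not_lt.1 h) (norm_nonneg _)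
      rw [this] at ht
      linarith
    have h1 := hfar p hp hbp t
    have h2 := hfar q hq (le_of_lt (lt_add_one _)) t
    have h3 : ‖t‖ ^ k * ‖iteratedFDeriv ℝ m (atomAt ψ p).1 t -
        iteratedFDeriv ℝ m (atomAt ψ q).1 t‖ ≤ ‖t‖ ^ k * ‖iteratedFDeriv ℝ m (atomAt ψ p).1 t‖ +
          ‖t‖ ^ k * ‖iteratedFDeriv ℝ m (atomAt ψ q).1 t‖ := by
      rw [← mul_add]
      gcongr
      exact norm_sub_le _ _
    refine h3.trans (le_of_mul_le_mul_left ?_ ht0)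
    linarith

theorem withSeminorms_testSpace (n : ℕ) :
    WithSeminorms ((schwartzSeminormFamily ℂ (EuclideanSpace ℝ (Fin n)) ℂ).comp
      (testSpace n).subtype) :=
  (testSpace n).subtype.withSeminorms_induced (schwartz_withSeminorms ℂ _ _)

theorem continuousOn_atomAt {n : ℕ} (ψ : testSpace n) :
    ContinuousOn (atomAt ψ) (upperHalfSpace n) := by
  intro q hq
  refine ContinuousAt.continuousWithinAt ?_
  refine ((withSeminorms_testSpace n).tendsto_nhds _ _).2 fun i ε hε => ?_
  filter_upwards [eventually_seminorm_atomAt_sub_le ψ i.1 i.2 hq (half_pos hε)] with p hp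
  exact lt_of_le_of_lt hp (half_lt_self hε)

/-- A continuous linear map on the test space is bounded by finitely many Schwartz seminorms. -/
theorem exists_bound_of_distribution {n : ℕ} {B : Type*} [NormedAddCommGroup B] [NormedSpace ℂ B]
    (T : testSpace n →L[ℂ] B) :
    ∃ (s : Finset (ℕ × ℕ)) (C : ℝ), 0 ≤ C ∧ ∀ φ : testSpace n,
      ‖T φ‖ ≤ C * (s.sup (schwartzSeminormFamily ℂ (EuclideanSpace ℝ (Fin n)) ℂ)) φ.1 := by
  obtain ⟨s, C, -, hC⟩ := Seminorm.bound_of_continuous (withSeminorms_testSpace n)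
    ((normSeminorm ℂ B).comp T.toLinearMap) (T.continuous.norm)
  refine ⟨s, C, C.2, fun φ => (hC φ).trans ?_⟩
  rw [← SeminormFamily.finset_sup_comp]
  rfl

/-- The values of a continuous linear map on the atoms grow at most polynomially. -/
theorem exists_norm_apply_atomAt_le {n : ℕ} {B : Type*} [NormedAddCommGroup B] [NormedSpace ℂ B]
    (T : testSpace n →L[ℂ] B) (ψ : testSpace n) :
    ∃ (C : ℝ) (a b : ℕ), 0 ≤ C ∧ ∀ p : EuclideanSpace ℝ (Fin n) × ℝ, 0 < p.2 →
      ‖T (atomAt ψ p)‖ ≤ C * (1 / p.2 + p.2) ^ a * (1 + ‖p.1‖) ^ b := by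
  obtain ⟨s, C, hC0, hC⟩ := exists_bound_of_distribution T
  choose D hD0 hD using fun i : ℕ × ℕ => exists_seminorm_atomSchwartz_le ψ.1 i.1 i.2
  let A := ∑ i ∈ s, (n + i.2 + i.1)
  let b := ∑ i ∈ s, i.1
  refine ⟨C * ∑ i ∈ s, D i, A, b, mul_nonneg hC0 (Finset.sum_nonneg fun i _ => hD0 i),
    fun p hp => ?_⟩
  have h3 := one_le_inv_add hp
  have h4 : 1 ≤ 1 + ‖p.1‖ := by linarith [norm_nonneg p.1]
  rw [atomAt_of_pos ψ hp]
  refine (hC _).trans ?_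
  rw [mul_assoc, mul_assoc]
  refine mul_le_mul_of_nonneg_left ?_ hC0
  refine Seminorm.finset_sup_apply_le (by have := Finset.sum_nonneg fun i (_ : i ∈ s) => hD0 i
                                          positivity) fun i hi => ?_
  refine (hD i p.1 p.2 hp).trans ?_
  rw [mul_assoc]
  have hsum : 0 ≤ ∑ i ∈ s, D i := Finset.sum_nonneg fun i _ => hD0 i
  gcongr
  · exact Finset.single_le_sum (f := D) (fun i _ => hD0 i) hi
  · exact Finset.single_le_sum (f := fun i : ℕ × ℕ => n + i.2 + i.1) (fun _ _ => Nat.zero_le _) hi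
  · exact Finset.single_le_sum (f := fun i : ℕ × ℕ => i.1) (fun _ _ => Nat.zero_le _) hi

/-! ### Decay of the synthesis kernel -/

/-- The homogeneous polynomial attached to a multilinear map, expanded in monomials. -/
theorem multilinear_apply_const_eq_sum {n j : ℕ}
    (M : (EuclideanSpace ℝ (Fin n)) [×j]→L[ℝ] ℂ) (t : EuclideanSpace ℝ (Fin n)) :
    M (fun _ => t) = ∑ r : Fin j → Fin n,
      M (fun i => EuclideanSpace.single (r i) 1) *
        (monomial (fun a => (Finset.univ.filter fun i => r i = a).card) t : ℂ) := by
  have ht : t = ∑ a, t a • EuclideanSpace.single a (1 : ℝ) := by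
    ext b
    simp [Finset.sum_apply, Pi.single_apply]
  have h1 : M (fun _ => t) = M (fun _ => ∑ a, t a • EuclideanSpace.single a (1 : ℝ)) := by
    rw [← ht]
  rw [h1, M.map_sum]
  refine Finset.sum_congr rfl fun r _ => ?_
  rw [M.map_smul_univ, Complex.real_smul, mul_comm]
  congr 2
  rw [monomial, ← Finset.prod_fiberwise Finset.univ r]
  refine Finset.prod_congr rfl fun a _ => ?_
  rw [Finset.prod_congr rfl (g := fun _ => t a) fun i hi => by rw [(Finset.mem_filter.1 hi).2],
    Finset.prod_const]

theorem integrable_multilinear_mul {n j : ℕ} (M : (EuclideanSpace ℝ (Fin n)) [×j]→L[ℝ] ℂ)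
    (η : 𝓢(EuclideanSpace ℝ (Fin n), ℂ)) : Integrable (fun t => M (fun _ => t) * η t) := by
  simp_rw [multilinear_apply_const_eq_sum M, Finset.sum_mul, mul_assoc]
  exact integrable_finsetSum _ fun r _ => (integrable_monomial_mul _ η).const_mul _

/-- Functions in `𝓢₀(ℝⁿ)` are orthogonal to all homogeneous polynomials. -/
theorem integral_multilinear_mul_eq_zero {n j : ℕ} (M : (EuclideanSpace ℝ (Fin n)) [×j]→L[ℝ] ℂ)
    (η : testSpace n) : ∫ t, M (fun _ => t) * η.1 t = 0 := by
  simp_rw [multilinear_apply_const_eq_sum M, Finset.sum_mul, mul_assoc]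
  rw [integral_finsetSum _ fun r _ => (integrable_monomial_mul _ η.1).const_mul _]
  refine Finset.sum_eq_zero fun r _ => ?_
  rw [integral_const_mul, η.2, mul_zero]

/-- The synthesis kernel `∫ φ (x + y t) η t dt`, at the point `p = (x, y)`. -/
def kernel {n : ℕ} (φ η : 𝓢(EuclideanSpace ℝ (Fin n), ℂ)) (p : EuclideanSpace ℝ (Fin n) × ℝ) : ℂ :=
  ∫ t, φ (p.1 + p.2 • t) * η t

/-- A bound for `(1 + ‖t‖) ^ k * ‖D ^ m φ t‖` in terms of the Schwartz seminorms. -/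
def decayBound {n : ℕ} (k m : ℕ) (φ : 𝓢(EuclideanSpace ℝ (Fin n), ℂ)) : ℝ :=
  2 ^ k * (Finset.Iic (k, m)).sup (schwartzSeminormFamily ℂ (EuclideanSpace ℝ (Fin n)) ℂ) φ

theorem decayBound_nonneg {n : ℕ} (k m : ℕ) (φ : 𝓢(EuclideanSpace ℝ (Fin n), ℂ)) :
    0 ≤ decayBound k m φ := by
  unfold decayBound; positivity

theorem pow_mul_norm_iteratedFDeriv_le {n : ℕ} (k m : ℕ) (φ : 𝓢(EuclideanSpace ℝ (Fin n), ℂ))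
    (t : EuclideanSpace ℝ (Fin n)) :
    (1 + ‖t‖) ^ k * ‖iteratedFDeriv ℝ m φ t‖ ≤ decayBound k m φ :=
  SchwartzMap.one_add_le_sup_seminorm_apply (m := (k, m)) le_rfl le_rfl φ t

theorem pow_mul_norm_le {n : ℕ} (k : ℕ) (φ : 𝓢(EuclideanSpace ℝ (Fin n), ℂ))
    (t : EuclideanSpace ℝ (Fin n)) : (1 + ‖t‖) ^ k * ‖φ t‖ ≤ decayBound k 0 φ := by
  simpa using pow_mul_norm_iteratedFDeriv_le k 0 φ t

theorem norm_le_decayBound {n : ℕ} (k : ℕ) (φ : 𝓢(EuclideanSpace ℝ (Fin n), ℂ))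
    (t : EuclideanSpace ℝ (Fin n)) : ‖φ t‖ ≤ decayBound k 0 φ * ((1 + ‖t‖) ^ k)⁻¹ := by
  rw [← div_eq_mul_inv, le_div_iff₀ (by positivity), mul_comm]
  exact pow_mul_norm_le k φ t

theorem integrable_inv_one_add_norm_pow (n : ℕ) :
    Integrable (fun t : EuclideanSpace ℝ (Fin n) => ((1 + ‖t‖) ^ (n + 1))⁻¹) := by
  have h := integrable_one_add_norm (E := EuclideanSpace ℝ (Fin n)) (μ := volume)
    (r := ((n + 1 : ℕ) : ℝ)) (by simp)
  refine h.congr (.of_forall fun t => ?_)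
  simp only [Real.rpow_neg (by positivity : 0 ≤ 1 + ‖t‖), Real.rpow_natCast]

theorem one_add_norm_le_mul {V : Type*} [NormedAddCommGroup V] [NormedSpace ℝ V] (x t : V) {c : ℝ}
    (hc0 : 0 ≤ c) (hc1 : c ≤ 1) : 1 + ‖x‖ ≤ (1 + ‖x + c • t‖) * (1 + ‖t‖) := by
  have h1 : ‖x‖ ≤ ‖x + c • t‖ + c * ‖t‖ := by
    calc ‖x‖ = ‖(x + c • t) - c • t‖ := by rw [add_sub_cancel_right]
      _ ≤ _ := (norm_sub_le _ _).trans_eq (by rw [norm_smul, Real.norm_of_nonneg hc0])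
  have h2 : c * ‖t‖ ≤ ‖t‖ := mul_le_of_le_one_left (norm_nonneg _) hc1
  nlinarith [norm_nonneg (x + c • t), norm_nonneg t,
    mul_nonneg (norm_nonneg (x + c • t)) (norm_nonneg t)]

/-- Taylor's formula with a remainder that decays in the base point. -/
theorem norm_sub_taylor_le {n : ℕ} (N l : ℕ) (φ : 𝓢(EuclideanSpace ℝ (Fin n), ℂ))
    (x t : EuclideanSpace ℝ (Fin n)) {y : ℝ} (hy0 : 0 ≤ y) (hy1 : y ≤ 1) :
    ‖φ (x + y • t) - ∑ j ∈ Finset.range (N + 1),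
        (((j.factorial : ℝ)⁻¹ * y ^ j : ℝ) : ℂ) * iteratedFDeriv ℝ j φ x (fun _ => t)‖ ≤
      y ^ (N + 1) * ((1 + ‖x‖) ^ l)⁻¹ * decayBound l (N + 1) φ * (1 + ‖t‖) ^ (N + 1 + l) := by
  have h := map_add_eq_sum_add_integral_iteratedFDeriv (f := φ) (x := x) (y := y • t) (n := N)
    fun s _ => φ.contDiffAt (N + 1 : ℕ)
  have hsm : ∀ j : ℕ, ∀ z : EuclideanSpace ℝ (Fin n), iteratedFDeriv ℝ j φ z (fun _ => y • t) =
      y ^ j • iteratedFDeriv ℝ j φ z (fun _ => t) := by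
    intro j z
    rw [(iteratedFDeriv ℝ j φ z).map_smul_univ (fun _ => y) (fun _ => t)]
    simp
  have hR : φ (x + y • t) - ∑ j ∈ Finset.range (N + 1),
        (((j.factorial : ℝ)⁻¹ * y ^ j : ℝ) : ℂ) * iteratedFDeriv ℝ j φ x (fun _ => t) =
      (N.factorial : ℝ)⁻¹ • ∫ s in (0 : ℝ)..1,
        (1 - s) ^ N • iteratedFDeriv ℝ (N + 1) φ (x + s • y • t) (fun _ => y • t) := by
    rw [h, sub_eq_iff_eq_add', add_left_inj]
    refine Finset.sum_congr rfl fun j _ => ?_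
    rw [hsm, smul_smul, Complex.real_smul]
  rw [hR, norm_smul]
  have hint : ‖∫ s in (0 : ℝ)..1,
      (1 - s) ^ N • iteratedFDeriv ℝ (N + 1) φ (x + s • y • t) (fun _ => y • t)‖ ≤
      (y ^ (N + 1) * ((1 + ‖x‖) ^ l)⁻¹ * decayBound l (N + 1) φ * (1 + ‖t‖) ^ (N + 1 + l)) *
        |1 - 0| := by
    refine intervalIntegral.norm_integral_le_of_norm_le_const fun s hs => ?_
    rw [Set.uIoc_of_le zero_le_one] at hs
    rw [hsm, norm_smul, norm_smul, norm_pow, norm_pow, Real.norm_of_nonneg hy0,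
      Real.norm_of_nonneg (by linarith [hs.2])]
    have h1 : (1 - s) ^ N ≤ 1 := pow_le_one₀ (by linarith [hs.2]) (by linarith [hs.1])
    have h2 := (iteratedFDeriv ℝ (N + 1) φ (x + s • y • t)).le_opNorm (fun _ => t)
    rw [Finset.prod_const, Finset.card_univ, Fintype.card_fin] at h2
    have h3 : ‖iteratedFDeriv ℝ (N + 1) φ (x + s • y • t)‖ ≤
        ((1 + ‖x‖) ^ l)⁻¹ * decayBound l (N + 1) φ * (1 + ‖t‖) ^ l := by
      have h4 := pow_mul_norm_iteratedFDeriv_le l (N + 1) φ (x + s • y • t)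
      have h5 : 1 + ‖x‖ ≤ (1 + ‖x + s • y • t‖) * (1 + ‖t‖) := by
        rw [smul_smul]
        exact one_add_norm_le_mul x t (mul_nonneg hs.1.le hy0) (mul_le_one₀ hs.2 hy0 hy1)
      have h6 : (1 + ‖x‖) ^ l ≤ (1 + ‖x + s • y • t‖) ^ l * (1 + ‖t‖) ^ l := by
        rw [← mul_pow]; gcongr
      rw [mul_assoc, ← div_eq_inv_mul, le_div_iff₀ (by positivity)]
      calc _ ≤ ‖iteratedFDeriv ℝ (N + 1) φ (x + s • y • t)‖ *
            ((1 + ‖x + s • y • t‖) ^ l * (1 + ‖t‖) ^ l) := by gcongr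
        _ = ((1 + ‖x + s • y • t‖) ^ l * ‖iteratedFDeriv ℝ (N + 1) φ (x + s • y • t)‖) *
            (1 + ‖t‖) ^ l := by ring
        _ ≤ _ := by gcongr
    have hD := decayBound_nonneg l (N + 1) φ
    calc (1 - s) ^ N * (y ^ (N + 1) *
          ‖iteratedFDeriv ℝ (N + 1) φ (x + s • y • t) (fun _ => t)‖)
        ≤ 1 * (y ^ (N + 1) * ((((1 + ‖x‖) ^ l)⁻¹ * decayBound l (N + 1) φ * (1 + ‖t‖) ^ l) *
          (1 + ‖t‖) ^ (N + 1))) := by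
          gcongr
          refine h2.trans ?_
          gcongr
          linarith
      _ = _ := by rw [pow_add (1 + ‖t‖) (N + 1) l]; ring
  rw [sub_zero, abs_one, mul_one] at hint
  refine (mul_le_of_le_one_left (norm_nonneg _) ?_).trans hint
  rw [norm_inv, Real.norm_natCast]
  exact inv_le_one_of_one_le₀ (mod_cast N.factorial_pos)

theorem integrable_kernel_integrand {n : ℕ} (φ η : 𝓢(EuclideanSpace ℝ (Fin n), ℂ))
    (p : EuclideanSpace ℝ (Fin n) × ℝ) : Integrable (fun t => φ (p.1 + p.2 • t) * η t) := by
  refine η.integrable.bdd_mul (c := SchwartzMap.seminorm ℂ 0 0 φ) ?_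
    (.of_forall fun t => SchwartzMap.norm_le_seminorm ℂ φ _)
  exact (φ.continuous.comp (by fun_prop)).aestronglyMeasurable

theorem continuous_kernel {n : ℕ} (φ η : 𝓢(EuclideanSpace ℝ (Fin n), ℂ)) :
    Continuous (kernel φ η) := by
  refine continuous_of_dominated
    (bound := fun t => SchwartzMap.seminorm ℂ 0 0 φ * ‖η t‖)
    (fun p => (integrable_kernel_integrand φ η p).aestronglyMeasurable)
    (fun p => .of_forall fun t => ?_) (η.integrable.norm.const_mul _) (.of_forall fun t => ?_)
  · rw [norm_mul]
    gcongr
    exact SchwartzMap.norm_le_seminorm ℂ φ _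
  · exact (φ.continuous.comp (by fun_prop)).mul continuous_const

/-- At small scales the moments of `η` annihilate the Taylor polynomials of `φ`. -/
theorem norm_kernel_le_of_le_one {n : ℕ} (N l : ℕ) (φ : 𝓢(EuclideanSpace ℝ (Fin n), ℂ))
    (η : testSpace n) (x : EuclideanSpace ℝ (Fin n)) {y : ℝ} (hy0 : 0 ≤ y) (hy1 : y ≤ 1) :
    ‖kernel φ η (x, y)‖ ≤ y ^ (N + 1) * ((1 + ‖x‖) ^ l)⁻¹ * decayBound l (N + 1) φ *
      (decayBound (N + 1 + l + (n + 1)) 0 η.1 *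
        ∫ t : EuclideanSpace ℝ (Fin n), ((1 + ‖t‖) ^ (n + 1))⁻¹) := by
  let T : EuclideanSpace ℝ (Fin n) → ℂ := fun t => ∑ j ∈ Finset.range (N + 1),
    (((j.factorial : ℝ)⁻¹ * y ^ j : ℝ) : ℂ) * iteratedFDeriv ℝ j φ x (fun _ => t)
  have hTi : ∀ j ∈ Finset.range (N + 1), Integrable fun t =>
      (((j.factorial : ℝ)⁻¹ * y ^ j : ℝ) : ℂ) *
        (iteratedFDeriv ℝ j φ x (fun _ => t) * η.1 t) := fun j _ =>
    (integrable_multilinear_mul (iteratedFDeriv ℝ j φ x) η.1).const_mul _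
  have hT : ∫ t, T t * η.1 t = 0 := by
    simp_rw [T, Finset.sum_mul, mul_assoc]
    rw [integral_finsetSum _ hTi]
    refine Finset.sum_eq_zero fun j _ => ?_
    rw [integral_const_mul, integral_multilinear_mul_eq_zero, mul_zero]
  have hTint : Integrable fun t => T t * η.1 t := by
    simp_rw [T, Finset.sum_mul, mul_assoc]
    exact integrable_finsetSum _ hTi
  have hK : kernel φ η (x, y) = ∫ t, (φ (x + y • t) - T t) * η.1 t := by
    simp_rw [sub_mul]
    rw [integral_sub (integrable_kernel_integrand φ η.1 (x, y)) hTint, hT, sub_zero]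
    rfl
  rw [hK, ← integral_const_mul, ← integral_const_mul]
  refine norm_integral_le_of_norm_le
    (((integrable_inv_one_add_norm_pow n).const_mul _).const_mul _) (.of_forall fun t => ?_)
  have hD := decayBound_nonneg l (N + 1) φ
  have h1 := norm_sub_taylor_le N l φ x t hy0 hy1
  have h2 := norm_le_decayBound (N + 1 + l + (n + 1)) η.1 t
  rw [norm_mul]
  calc ‖φ (x + y • t) - T t‖ * ‖η.1 t‖
      ≤ (y ^ (N + 1) * ((1 + ‖x‖) ^ l)⁻¹ * decayBound l (N + 1) φ * (1 + ‖t‖) ^ (N + 1 + l)) *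
        (decayBound (N + 1 + l + (n + 1)) 0 η.1 * ((1 + ‖t‖) ^ (N + 1 + l + (n + 1)))⁻¹) := by
        gcongr
    _ = _ := by
        rw [pow_add _ (N + 1 + l)]
        field_simp

/-- The two functions entering the kernel may be exchanged, at the price of inverting the scale. -/
theorem kernel_swap {n : ℕ} (φ η : 𝓢(EuclideanSpace ℝ (Fin n), ℂ))
    (x : EuclideanSpace ℝ (Fin n)) {y : ℝ} (hy : 0 < y) :
    kernel φ η (x, y) = ((y⁻¹ ^ n : ℝ) : ℂ) * kernel η φ (-(y⁻¹ • x), y⁻¹) := by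
  have h1 : kernel φ η (x, y) =
      ∫ t, (fun s => φ (x + s) * η (y⁻¹ • s)) (y • t) := by
    refine integral_congr_ae (.of_forall fun t => ?_)
    simp [inv_smul_smul₀ hy.ne']
  rw [h1, Measure.integral_comp_smul volume (fun s => φ (x + s) * η (y⁻¹ • s)) y,
    finrank_euclideanSpace_fin,
    ← integral_add_left_eq_self (fun s => φ (x + s) * η (y⁻¹ • s)) (-x), abs_of_pos (by positivity),
    Complex.real_smul, inv_pow]
  congr 1
  refine integral_congr_ae (.of_forall fun t => ?_)
  simp only [smul_add, smul_neg, add_neg_cancel_left]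
  rw [mul_comm]

/-- The synthesis kernel decays rapidly in all directions of the upper half-space, with constants
controlled by finitely many Schwartz seminorms of `φ`. -/
theorem exists_norm_kernel_le {n : ℕ} (η : testSpace n) (k l : ℕ) :
    ∃ (s : Finset (ℕ × ℕ)) (C : ℝ), 0 ≤ C ∧ ∀ (φ : testSpace n)
      (p : EuclideanSpace ℝ (Fin n) × ℝ), 0 < p.2 → p.2⁻¹ * ‖kernel φ.1 η.1 p‖ ≤
        C * (s.sup (schwartzSeminormFamily ℂ (EuclideanSpace ℝ (Fin n)) ℂ)) φ.1 *
          (((1 / p.2 + p.2) ^ k)⁻¹ * ((1 + ‖p.1‖) ^ l)⁻¹) := by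
  set I := ∫ t : EuclideanSpace ℝ (Fin n), ((1 + ‖t‖) ^ (n + 1))⁻¹ with hI
  have hI0 : 0 ≤ I := integral_nonneg fun t => by positivity
  set N := k + l with hN
  set r := N + 1 + l + (n + 1) with hr
  set D1 := decayBound (k + 1 + l + (n + 1)) 0 η.1 * I with hD1
  have hD1' : 0 ≤ D1 := mul_nonneg (decayBound_nonneg _ _ _) hI0
  set D2 := decayBound l (N + 1) η.1 * I with hD2
  have hD2' : 0 ≤ D2 := mul_nonneg (decayBound_nonneg _ _ _) hI0
  set s := Finset.Iic (l, k + 1) ∪ Finset.Iic (r, 0) with hs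
  refine ⟨s, 2 ^ k * (2 ^ l * D1 + 2 ^ r * D2), by positivity, fun φ p hp => ?_⟩
  obtain ⟨x, y⟩ := p
  change 0 < y at hp
  change y⁻¹ * ‖kernel φ.1 η.1 (x, y)‖ ≤ _ * (((1 / y + y) ^ k)⁻¹ * ((1 + ‖x‖) ^ l)⁻¹)
  set S := (s.sup (schwartzSeminormFamily ℂ (EuclideanSpace ℝ (Fin n)) ℂ)) φ.1 with hS
  have hS0 : 0 ≤ S := by positivity
  have hS1 : decayBound l (k + 1) φ.1 ≤ 2 ^ l * S := by
    unfold decayBound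
    gcongr
    exact Seminorm.le_def.1 (Finset.sup_mono Finset.subset_union_left) _
  have hS2 : decayBound r 0 φ.1 ≤ 2 ^ r * S := by
    unfold decayBound
    gcongr
    exact Seminorm.le_def.1 (Finset.sup_mono Finset.subset_union_right) _
  rcases le_total y 1 with hy1 | hy1
  · have h1 := norm_kernel_le_of_le_one k l φ.1 η x hp.le hy1
    have h2 : y ^ k ≤ 2 ^ k * ((1 / y + y) ^ k)⁻¹ := by
      rw [← inv_pow, ← mul_pow]
      gcongr
      rw [← div_eq_mul_inv, le_div_iff₀ (by positivity), mul_add, mul_one_div_cancel hp.ne']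
      nlinarith
    calc y⁻¹ * ‖kernel φ.1 η.1 (x, y)‖
        ≤ y⁻¹ * (y ^ (k + 1) * ((1 + ‖x‖) ^ l)⁻¹ * (2 ^ l * S) * D1) := by
          gcongr
          refine h1.trans ?_
          gcongr
      _ = y ^ k * (((1 + ‖x‖) ^ l)⁻¹ * (2 ^ l * S) * D1) := by
          rw [pow_succ]; field_simp
      _ ≤ (2 ^ k * ((1 / y + y) ^ k)⁻¹) * (((1 + ‖x‖) ^ l)⁻¹ * (2 ^ l * S) * D1) := by
          gcongr
      _ = 2 ^ k * (2 ^ l * D1) * S * (((1 / y + y) ^ k)⁻¹ * ((1 + ‖x‖) ^ l)⁻¹) := by ring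
      _ ≤ _ := by
          gcongr
          exact le_add_of_nonneg_right (by positivity)
  -- At large scales the roles are exchanged; `l` of the `N = k + l` powers of `y⁻¹` are spent on
  -- replacing the decay in `x / y` by decay in `x`.
  · have hyi : y⁻¹ ≤ 1 := inv_le_one_of_one_le₀ hy1
    have h1 := norm_kernel_le_of_le_one N l η.1 φ (-(y⁻¹ • x)) (inv_nonneg.2 hp.le) hyi
    have h2 : y⁻¹ ^ k ≤ 2 ^ k * ((1 / y + y) ^ k)⁻¹ := by
      rw [← inv_pow, ← mul_pow]
      gcongr
      rw [← div_eq_mul_inv, le_div_iff₀ (by positivity), mul_add, inv_mul_cancel₀ hp.ne', one_div]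
      nlinarith [inv_pos.2 hp]
    have h3 : ((1 + ‖-(y⁻¹ • x)‖) ^ l)⁻¹ ≤ y ^ l * ((1 + ‖x‖) ^ l)⁻¹ := by
      rw [← inv_pow, ← inv_pow, ← mul_pow]
      gcongr
      rw [norm_neg, norm_smul, norm_inv, Real.norm_of_nonneg hp.le, ← div_eq_mul_inv,
        le_div_iff₀ (by positivity), inv_mul_le_iff₀ (by positivity), add_mul, one_mul,
        mul_right_comm,
        inv_mul_cancel₀ hp.ne', one_mul]
      linarith
    rw [kernel_swap _ _ _ hp, norm_mul, Complex.norm_real, Real.norm_of_nonneg (by positivity)]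
    calc y⁻¹ * (y⁻¹ ^ n * ‖kernel η.1 φ.1 (-(y⁻¹ • x), y⁻¹)‖)
        ≤ 1 * (1 * (y⁻¹ ^ (N + 1) * (y ^ l * ((1 + ‖x‖) ^ l)⁻¹) * decayBound l (N + 1) η.1 *
          ((2 ^ r * S) * I))) := by
          gcongr
          · exact pow_le_one₀ (inv_nonneg.2 hp.le) hyi
          · refine h1.trans ?_
            have := decayBound_nonneg l (N + 1) η.1
            have := mul_nonneg (decayBound_nonneg r 0 φ.1) hI0
            gcongr
      _ = y⁻¹ ^ k * y⁻¹ * (((1 + ‖x‖) ^ l)⁻¹ * (2 ^ r * S) * D2) := by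
          rw [hN, pow_succ, pow_add, inv_pow y l]; field_simp; rw [hD2, hN]; ring
      _ ≤ (2 ^ k * ((1 / y + y) ^ k)⁻¹) * 1 * (((1 + ‖x‖) ^ l)⁻¹ * (2 ^ r * S) * D2) := by
          gcongr
      _ = 2 ^ k * (2 ^ r * D2) * S * (((1 / y + y) ^ k)⁻¹ * ((1 + ‖x‖) ^ l)⁻¹) := by ring
      _ ≤ _ := by
          gcongr
          exact le_add_of_nonneg_left (by positivity)

/-! ### Test functions with Fourier transform vanishing near the origin -/

theorem eventually_lineDerivOp_eq_zero {n : ℕ} {θ : 𝓢(EuclideanSpace ℝ (Fin n), ℂ)}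
    (hθ : ∀ᶠ ξ in 𝓝 0, θ ξ = 0) (v : EuclideanSpace ℝ (Fin n)) :
    ∀ᶠ ξ in 𝓝 0, (∂_{v} θ) ξ = 0 := by
  have h : (θ : EuclideanSpace ℝ (Fin n) → ℂ) =ᶠ[𝓝 0] fun _ => 0 := hθ
  filter_upwards [h.fderiv (𝕜 := ℝ)] with ξ hξ
  rw [SchwartzMap.lineDerivOp_apply_eq_fderiv, hξ]
  simp

/-- Multiplication by a monomial preserves the inverse Fourier transforms of Schwartz functions
vanishing near the origin. -/
theorem exists_monomial_mul_fourierInv {n : ℕ} (m : Fin n → ℕ)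
    {θ : 𝓢(EuclideanSpace ℝ (Fin n), ℂ)} (hθ : ∀ᶠ ξ in 𝓝 0, θ ξ = 0) :
    ∃ θ' : 𝓢(EuclideanSpace ℝ (Fin n), ℂ), (∀ᶠ ξ in 𝓝 0, θ' ξ = 0) ∧
      ∀ t, (monomial m t : ℂ) * (𝓕⁻ θ) t = (𝓕⁻ θ') t := by
  -- The property is multiplicative in the factor, so it suffices to treat the coordinates.
  let Q : (EuclideanSpace ℝ (Fin n) → ℝ) → Prop := fun g =>
    ∀ θ : 𝓢(EuclideanSpace ℝ (Fin n), ℂ), (∀ᶠ ξ in 𝓝 0, θ ξ = 0) →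
      ∃ θ' : 𝓢(EuclideanSpace ℝ (Fin n), ℂ), (∀ᶠ ξ in 𝓝 0, θ' ξ = 0) ∧
        ∀ t, (g t : ℂ) * (𝓕⁻ θ) t = (𝓕⁻ θ') t
  have hone : Q 1 := fun θ hθ => ⟨θ, hθ, fun t => by simp⟩
  have hmul : ∀ g₁ g₂, Q g₁ → Q g₂ → Q (g₁ * g₂) := by
    intro g₁ g₂ h₁ h₂ θ hθ
    obtain ⟨θ₂, hθ₂, e₂⟩ := h₂ θ hθ
    obtain ⟨θ₁, hθ₁, e₁⟩ := h₁ θ₂ hθ₂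
    refine ⟨θ₁, hθ₁, fun t => ?_⟩
    rw [← e₁, ← e₂, Pi.mul_apply, Complex.ofReal_mul, mul_assoc]
  have hcoord : ∀ i, Q fun t => t i := by
    intro i θ hθ
    have hc : -(2 * (Real.pi : ℂ) * Complex.I) ≠ 0 := by
      simp [Real.pi_ne_zero, Complex.I_ne_zero]
    refine ⟨(-(2 * (Real.pi : ℂ) * Complex.I))⁻¹ • ∂_{EuclideanSpace.single i (1 : ℝ)} θ, ?_,
      fun t => ?_⟩
    · filter_upwards [eventually_lineDerivOp_eq_zero hθ (EuclideanSpace.single i (1 : ℝ))] with ξ hξ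
      simp [hξ]
    · have hg : (inner ℝ · (EuclideanSpace.single i (1 : ℝ)) :
          EuclideanSpace ℝ (Fin n) → ℝ).HasTemperateGrowth := by fun_prop
      rw [FourierTransform.fourierInv_smul, SchwartzMap.fourierInv_lineDerivOp_eq, smul_smul,
        inv_mul_cancel₀ hc, one_smul, SchwartzMap.smulLeftCLM_apply_apply hg]
      simp [EuclideanSpace.inner_single_right]
  have hpow : ∀ i (k : ℕ), Q fun t => t i ^ k := by
    intro i k
    induction k with
    | zero => exact fun θ hθ => ⟨θ, hθ, fun t => by simp⟩
    | succ k ih =>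
      have := hmul _ _ ih (hcoord i)
      simp_rw [pow_succ]
      exact this
  have hprod : ∀ s : Finset (Fin n), Q fun t => ∏ i ∈ s, t i ^ m i := by
    intro s
    induction s using Finset.cons_induction with
    | empty => exact hone
    | cons i s hi ih =>
      have := hmul _ _ (hpow i (m i)) ih
      simp_rw [Finset.prod_cons]
      exact this
  exact hprod Finset.univ θ hθ

theorem fourierInv_mem_testSpace {n : ℕ} {θ : 𝓢(EuclideanSpace ℝ (Fin n), ℂ)}
    (hθ : ∀ᶠ ξ in 𝓝 0, θ ξ = 0) : 𝓕⁻ θ ∈ testSpace n := by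
  intro m
  obtain ⟨θ', hθ', h⟩ := exists_monomial_mul_fourierInv m hθ
  simp_rw [h]
  have h1 : (𝓕 (𝓕⁻ θ')) 0 = ∫ t, (𝓕⁻ θ') t := by
    rw [SchwartzMap.fourier_coe, Real.fourier_eq]
    simp
  rw [← h1, FourierTransform.fourier_fourierInv_eq]
  exact hθ'.self_of_nhds

/-! ### The radial normalisation -/

/-- The integral of `W` over the ray through `ξ`, for the measure `dy / y`. -/
def rayIntegral {V : Type*} [SMul ℝ V] (W : V → ℝ) (ξ : V) : ℝ :=
  ∫ y in Ioi (0 : ℝ), y⁻¹ * W (y • ξ)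

section RayIntegral

variable {V : Type*} [NormedAddCommGroup V] [NormedSpace ℝ V] {W : V → ℝ} {a b : ℝ}

theorem rayIntegral_smul (W : V → ℝ) (ξ : V) {r : ℝ} (hr : 0 < r) :
    rayIntegral W (r • ξ) = rayIntegral W ξ := by
  have h := integral_comp_mul_left_Ioi (fun y => y⁻¹ * W (y • ξ)) 0 hr
  rw [mul_zero] at h
  unfold rayIntegral
  rw [← mul_right_inj' (inv_ne_zero hr.ne'),
    ← smul_eq_mul (r⁻¹) (∫ y in Ioi (0 : ℝ), y⁻¹ * W (y • ξ)),
    ← h, ← integral_const_mul]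
  refine setIntegral_congr_fun measurableSet_Ioi fun y _ => ?_
  simp only [smul_smul, mul_inv, mul_comm r y]
  ring

/-- If `W` is supported in an annulus, only a compact range of scales meets its support. -/
theorem smul_mem_Icc_of_ne_zero (hsupp : ∀ ξ, W ξ ≠ 0 → ‖ξ‖ ∈ Icc a b) {ξ : V}
    {R₁ R₂ : ℝ} (hR₁ : 0 < R₁) (h₁ : R₁ ≤ ‖ξ‖) (h₂ : ‖ξ‖ ≤ R₂) {y : ℝ} (hy : W (y • ξ) ≠ 0) :
    |y| ∈ Icc (a / R₂) (b / R₁) := by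
  obtain ⟨h3, h4⟩ := hsupp _ hy
  rw [norm_smul, Real.norm_eq_abs] at h3 h4
  have hR₂ : 0 < R₂ := hR₁.trans_le (h₁.trans h₂)
  constructor
  · rw [div_le_iff₀ hR₂]
    exact h3.trans (by gcongr)
  · rw [le_div_iff₀ hR₁]
    exact le_trans (by gcongr) h4

theorem integrableOn_ray (hW : Continuous W) (ha : 0 < a)
    (hsupp : ∀ ξ, W ξ ≠ 0 → ‖ξ‖ ∈ Icc a b) {ξ : V} (hξ : ξ ≠ 0) :
    IntegrableOn (fun y : ℝ => y⁻¹ * W (y • ξ)) (Ioi 0) := by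
  have hξ' : 0 < ‖ξ‖ := norm_pos_iff.2 hξ
  have h1 : IntegrableOn (fun y : ℝ => y⁻¹ * W (y • ξ)) (Icc (a / ‖ξ‖) (b / ‖ξ‖)) := by
    refine ContinuousOn.integrableOn_compact isCompact_Icc ?_
    refine ContinuousOn.mul (continuousOn_inv₀.mono fun y hy => ?_) (by fun_prop)
    exact ((div_pos ha hξ').trans_le hy.1).ne'
  refine h1.of_forall_sdiff_eq_zero measurableSet_Ioi fun y hy => ?_
  by_contra h
  have := smul_mem_Icc_of_ne_zero hsupp hξ' le_rfl le_rfl (right_ne_zero_of_mul h)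
  rw [abs_of_pos hy.1] at this
  exact hy.2 this

theorem rayIntegral_pos (hW : Continuous W) (hW0 : ∀ ξ, 0 ≤ W ξ) (ha : 0 < a)
    (hsupp : ∀ ξ, W ξ ≠ 0 → ‖ξ‖ ∈ Icc a b)
    (hne : ∀ v : V, ‖v‖ = 1 → ∃ r : ℝ, 0 < r ∧ W (r • v) ≠ 0)
    {ξ : V} (hξ : ξ ≠ 0) : 0 < rayIntegral W ξ := by
  have hξ' : 0 < ‖ξ‖ := norm_pos_iff.2 hξ
  have hv : ‖ξ‖ • (‖ξ‖⁻¹ • ξ) = ξ := smul_inv_smul₀ hξ'.ne' ξ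
  rw [← hv, rayIntegral_smul W _ hξ']
  have hv0 : ‖ξ‖⁻¹ • ξ ≠ 0 := smul_ne_zero (inv_ne_zero hξ'.ne') hξ
  obtain ⟨r, hr, hWr⟩ := hne (‖ξ‖⁻¹ • ξ)
    (by rw [norm_smul, norm_inv, norm_norm, inv_mul_cancel₀ hξ'.ne'])
  unfold rayIntegral
  rw [setIntegral_pos_iff_support_of_nonneg_ae _ (integrableOn_ray hW ha hsupp hv0)]
  · have hopen : IsOpen {y : ℝ | 0 < y ∧ W (y • ‖ξ‖⁻¹ • ξ) ≠ 0} :=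
      isOpen_Ioi.inter (isOpen_ne_fun (by fun_prop) continuous_const)
    refine (hopen.measure_pos volume ⟨r, hr, hWr⟩).trans_le (measure_mono fun y hy => ?_)
    exact ⟨mul_ne_zero (inv_ne_zero hy.1.ne') hy.2, hy.1⟩
  · refine (ae_restrict_iff' measurableSet_Ioi).2 (.of_forall fun y hy => ?_)
    exact mul_nonneg (inv_nonneg.2 (le_of_lt hy)) (hW0 _)

/-- Off the origin the ray integral of a smooth function supported in an annulus is smooth, being
locally a convolution with parameters. -/
theorem contDiffAt_rayIntegral (hW : ContDiff ℝ ∞ W) (ha : 0 < a)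
    (hsupp : ∀ ξ, W ξ ≠ 0 → ‖ξ‖ ∈ Icc a b) {ξ : V} (hξ : ξ ≠ 0) :
    ContDiffAt ℝ ∞ (rayIntegral W) ξ := by
  have hξ' : 0 < ‖ξ‖ := norm_pos_iff.2 hξ
  set s : Set V := {ζ | ‖ξ‖ / 2 < ‖ζ‖ ∧ ‖ζ‖ < 2 * ‖ξ‖} with hs
  have hsopen : IsOpen s :=
    (isOpen_lt continuous_const continuous_norm).inter (isOpen_lt continuous_norm continuous_const)
  have hξs : ξ ∈ s := ⟨by linarith, by linarith⟩
  set α := a / (2 * ‖ξ‖) with hα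
  set β := b / (‖ξ‖ / 2) with hβ
  have hα0 : 0 < α := by positivity
  have hmem : ∀ ζ ∈ s, ∀ y : ℝ, W (y • ζ) ≠ 0 → |y| ∈ Icc α β := fun ζ hζ y hy =>
    smul_mem_Icc_of_ne_zero hsupp (half_pos hξ') hζ.1.le hζ.2.le hy
  -- Near `ξ` the integral only sees scales in `[α, β]`, and it is a convolution evaluated at `0`.
  let f : ℝ → ℝ := (Icc α β).indicator fun y => y⁻¹
  let g : V → ℝ → ℝ := fun ζ y => W (-y • ζ)
  have hf : LocallyIntegrable f := by
    refine Integrable.locallyIntegrable ((integrable_indicator_iff measurableSet_Icc).2 ?_)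
    refine ContinuousOn.integrableOn_compact isCompact_Icc (continuousOn_inv₀.mono fun y hy => ?_)
    exact (hα0.trans_le hy.1).ne'
  have hg : ContDiffOn ℝ ∞ ↿g (s ×ˢ univ) := by
    refine ContDiff.contDiffOn (hW.comp ?_)
    exact (contDiff_snd.neg).smul contDiff_fst
  have hgs : ∀ p, ∀ y, p ∈ s → y ∉ Icc (-β) β → g p y = 0 := by
    intro p y hp hy
    by_contra h
    have := (hmem p hp _ h).2
    rw [abs_neg] at this
    exact hy (abs_le.1 this)
  have hconv := contDiffOn_convolution_right_with_param_comp (n := ⊤) (μ := volume)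
    (ContinuousLinearMap.mul ℝ ℝ) (contDiffOn_const (c := (0 : ℝ))) hsopen isCompact_Icc hgs hf hg
  refine (hconv.contDiffAt (hsopen.mem_nhds hξs)).congr_of_eventuallyEq ?_
  filter_upwards [hsopen.mem_nhds hξs] with ζ hζ
  rw [convolution_def, rayIntegral, ← integral_indicator measurableSet_Ioi]
  refine integral_congr_ae (.of_forall fun y => ?_)
  simp only [ContinuousLinearMap.mul_apply', f, g, zero_sub, neg_neg]
  by_cases hy : W (y • ζ) = 0
  · simp [hy, indicator]
  · have h1 := hmem ζ hζ y hy
    by_cases hy0 : 0 < y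
    · rw [abs_of_pos hy0] at h1
      rw [indicator_of_mem (show y ∈ Ioi 0 from hy0), indicator_of_mem h1]
    · have h2 : y ∉ Icc α β := fun h => hy0 (hα0.trans_le h.1)
      rw [indicator_of_notMem (show y ∉ Ioi 0 from hy0), indicator_of_notMem h2, zero_mul]

end RayIntegral

/-! ### The reconstruction wavelet -/

/-- If `Ψ` vanishes identically on no ray, then by compactness of the sphere a single annulus meets
the non-vanishing set of `Ψ` along every ray. -/
theorem exists_annulus {V : Type*} [NormedAddCommGroup V] [NormedSpace ℝ V] [ProperSpace V]
    {Ψ : V → ℂ} (hΨ : Continuous Ψ) (hne : ∀ v : V, ‖v‖ = 1 → ∃ r : ℝ, 0 < r ∧ Ψ (r • v) ≠ 0) :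
    ∃ a b : ℝ, 0 < a ∧ ∀ v : V, ‖v‖ = 1 → ∃ r : ℝ, a < r ∧ r < b ∧ Ψ (r • v) ≠ 0 := by
  let U : ℕ → Set V := fun j => ⋃ r ∈ Ioo (1 / ((j : ℝ) + 1)) (j + 1), {v | Ψ (r • v) ≠ 0}
  have hUo : ∀ j, IsOpen (U j) := fun j =>
    isOpen_biUnion fun r _ => isOpen_ne_fun (by fun_prop) continuous_const
  have hUm : Monotone U := by
    intro i j hij
    refine biUnion_subset_biUnion_left (Ioo_subset_Ioo ?_ (by gcongr))
    gcongr
  have hcov : Metric.sphere (0 : V) 1 ⊆ ⋃ j, U j := by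
    intro v hv
    obtain ⟨r, hr, h⟩ := hne v (mem_sphere_zero_iff_norm.1 hv)
    obtain ⟨i, hi⟩ := exists_nat_one_div_lt hr
    obtain ⟨j, hj⟩ := exists_nat_gt r
    refine mem_iUnion.2 ⟨max i j, mem_biUnion (x := r) ⟨lt_of_le_of_lt ?_ hi, ?_⟩ h⟩
    · gcongr
      exact le_max_left _ _
    · have : (j : ℝ) ≤ (max i j : ℕ) := by exact_mod_cast le_max_right _ _
      linarith
  obtain ⟨j, hj⟩ := (isCompact_sphere (0 : V) 1).elim_directed_cover U hUo hcov hUm.directed_le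
  refine ⟨1 / ((j : ℝ) + 1), j + 1, by positivity, fun v hv => ?_⟩
  obtain ⟨r, hr, h⟩ := mem_iUnion₂.1 (hj (mem_sphere_zero_iff_norm.2 hv))
  exact ⟨r, hr.1, hr.2, h⟩

/-- A Schwartz function that vanishes on no ray has a dual function `θ`, smooth and supported in an
annulus, for which the Calderón integral equals one along every ray. -/
theorem exists_dual_multiplier {n : ℕ} (Ψ : 𝓢(EuclideanSpace ℝ (Fin n), ℂ))
    (hne : ∀ v : EuclideanSpace ℝ (Fin n), ‖v‖ = 1 → ∃ r : ℝ, 0 < r ∧ Ψ (r • v) ≠ 0) :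
    ∃ θ : 𝓢(EuclideanSpace ℝ (Fin n), ℂ), (∀ᶠ ξ in 𝓝 0, θ ξ = 0) ∧
      ∀ ξ, ξ ≠ 0 → ∫ y in Ioi (0 : ℝ), (y⁻¹ : ℂ) * (conj (Ψ (y • ξ)) * θ (y • ξ)) = 1 := by
  obtain ⟨a, b, ha, hab⟩ := exists_annulus Ψ.continuous hne
  -- A smooth function of `‖ξ‖ ^ 2`, positive exactly for `a < ‖ξ‖ < |b|`.
  let χ : EuclideanSpace ℝ (Fin n) → ℝ := fun ξ =>
    expNegInvGlue (‖ξ‖ ^ 2 - a ^ 2) * expNegInvGlue (b ^ 2 - ‖ξ‖ ^ 2)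
  have hχs : ContDiff ℝ ∞ χ :=
    (expNegInvGlue.contDiff.comp ((contDiff_norm_sq ℝ).sub contDiff_const)).mul
      (expNegInvGlue.contDiff.comp (contDiff_const.sub (contDiff_norm_sq ℝ)))
  have hχ0 : ∀ ξ, 0 ≤ χ ξ := fun ξ =>
    mul_nonneg (expNegInvGlue.nonneg _) (expNegInvGlue.nonneg _)
  have hχsupp : ∀ ξ, χ ξ ≠ 0 → ‖ξ‖ ∈ Icc a |b| := by
    intro ξ hξ
    have h1 : 0 < ‖ξ‖ ^ 2 - a ^ 2 := by
      by_contra h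
      exact hξ (by simp only [χ, expNegInvGlue.zero_of_nonpos (not_lt.1 h), zero_mul])
    have h2 : 0 < b ^ 2 - ‖ξ‖ ^ 2 := by
      by_contra h
      exact hξ (by simp only [χ, expNegInvGlue.zero_of_nonpos (not_lt.1 h), mul_zero])
    exact ⟨le_of_sq_le_sq (by linarith) (norm_nonneg _), by
      rw [← abs_norm]; exact sq_le_sq.1 (by linarith)⟩
  let W : EuclideanSpace ℝ (Fin n) → ℝ := fun ξ => ‖Ψ ξ‖ ^ 2 * χ ξ
  have hWs : ContDiff ℝ ∞ W := ((Ψ.smooth ⊤).norm_sq ℝ).mul hχs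
  have hW0 : ∀ ξ, 0 ≤ W ξ := fun ξ => mul_nonneg (sq_nonneg _) (hχ0 ξ)
  have hWsupp : ∀ ξ, W ξ ≠ 0 → ‖ξ‖ ∈ Icc a |b| := fun ξ hξ => hχsupp ξ (right_ne_zero_of_mul hξ)
  have hWne : ∀ v : EuclideanSpace ℝ (Fin n), ‖v‖ = 1 → ∃ r : ℝ, 0 < r ∧ W (r • v) ≠ 0 := by
    intro v hv
    obtain ⟨r, h1, h2, h3⟩ := hab v hv
    have hr : 0 < r := ha.trans h1
    have hn : ‖r • v‖ = r := by rw [norm_smul, hv, mul_one, Real.norm_of_nonneg hr.le]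
    refine ⟨r, hr, mul_ne_zero (pow_ne_zero _ (norm_ne_zero_iff.2 h3)) (mul_ne_zero ?_ ?_)⟩
    · exact (expNegInvGlue.pos_of_pos (by rw [hn]; nlinarith)).ne'
    · exact (expNegInvGlue.pos_of_pos (by rw [hn]; nlinarith)).ne'
  let c := rayIntegral W
  have hcpos : ∀ ξ, ξ ≠ 0 → 0 < c ξ := fun ξ hξ =>
    rayIntegral_pos hWs.continuous hW0 ha hWsupp hWne hξ
  -- Dividing by the dilation-invariant `c` normalises the integral along every ray to one.
  let τ : EuclideanSpace ℝ (Fin n) → ℝ := fun ξ => χ ξ * (c ξ)⁻¹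
  have hτ0 : ∀ᶠ ξ in 𝓝 0, τ ξ = 0 := by
    filter_upwards [Metric.ball_mem_nhds (0 : EuclideanSpace ℝ (Fin n)) ha] with ξ hξ
    have : χ ξ = 0 := by
      by_contra h
      exact absurd (mem_ball_zero_iff.1 hξ) (not_lt.2 (hχsupp ξ h).1)
    simp only [τ, this, zero_mul]
  have hτs : ContDiff ℝ ∞ τ := by
    rw [contDiff_iff_contDiffAt]
    intro ξ
    by_cases hξ : ξ = 0
    · subst hξ
      exact contDiffAt_const.congr_of_eventuallyEq hτ0
    · exact hχs.contDiffAt.mul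
        ((contDiffAt_rayIntegral hWs ha hWsupp hξ).inv (hcpos ξ hξ).ne')
  -- Taking `Ψ` rather than its conjugate turns `conj Ψ * ϑ` into `W / c`.
  let ϑ : EuclideanSpace ℝ (Fin n) → ℂ := fun ξ => Ψ ξ * (τ ξ : ℂ)
  have hϑs : ContDiff ℝ ∞ ϑ :=
    (Ψ.smooth ⊤).mul (Complex.ofRealCLM.contDiff.comp hτs)
  have hϑc : HasCompactSupport ϑ := by
    refine HasCompactSupport.of_support_subset_isCompact
      (isCompact_closedBall (0 : EuclideanSpace ℝ (Fin n)) |b|) fun ξ hξ => ?_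
    rw [mem_closedBall_zero_iff]
    have h1 : τ ξ ≠ 0 := fun h => hξ (by simp only [ϑ, h, Complex.ofReal_zero, mul_zero])
    exact (hχsupp ξ (left_ne_zero_of_mul h1)).2
  refine ⟨hϑc.toSchwartzMap hϑs, ?_, fun ξ hξ => ?_⟩
  · filter_upwards [hτ0] with ξ hξ
    simp [ϑ, hξ]
  · have h1 : ∀ y ∈ Ioi (0 : ℝ), (y⁻¹ : ℂ) * (conj (Ψ (y • ξ)) * hϑc.toSchwartzMap hϑs (y • ξ)) =
        (((y⁻¹ * W (y • ξ)) * (c ξ)⁻¹ : ℝ) : ℂ) := by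
      intro y hy
      have h2 : c (y • ξ) = c ξ := rayIntegral_smul W ξ hy
      have h3 : hϑc.toSchwartzMap hϑs (y • ξ) = Ψ (y • ξ) * ((χ (y • ξ) * (c ξ)⁻¹ : ℝ) : ℂ) := by
        rw [← h2]; rfl
      rw [h3]
      simp only [W]
      push_cast
      rw [← Complex.conj_mul']
      ring
    rw [setIntegral_congr_fun measurableSet_Ioi h1, integral_complex_ofReal, integral_mul_const]
    change ((c ξ * (c ξ)⁻¹ : ℝ) : ℂ) = 1
    rw [mul_inv_cancel₀ (hcpos ξ hξ).ne', Complex.ofReal_one]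

theorem fourierHat_eq {n : ℕ} (ψ : 𝓢(EuclideanSpace ℝ (Fin n), ℂ))
    (u : EuclideanSpace ℝ (Fin n)) : fourierHat ψ u = (𝓕 ψ) ((2 * Real.pi)⁻¹ • u) := by
  rw [SchwartzMap.fourier_coe, Real.fourier_eq', fourierHat]
  refine integral_congr_ae (.of_forall fun t => ?_)
  simp only [smul_eq_mul]
  rw [mul_comm, inner_smul_right, real_inner_comm]
  congr 2
  push_cast
  have : (Real.pi : ℂ) ≠ 0 := by exact_mod_cast Real.pi_ne_zero
  field_simp

theorem NonDegenerate.exists_fourier_ne_zero {n : ℕ} {ψ : 𝓢(EuclideanSpace ℝ (Fin n), ℂ)}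
    (hψ : NonDegenerate ψ) (v : EuclideanSpace ℝ (Fin n)) (hv : ‖v‖ = 1) :
    ∃ r : ℝ, 0 < r ∧ (𝓕 ψ) (r • v) ≠ 0 := by
  obtain ⟨r, hr, h⟩ := hψ v hv
  refine ⟨(2 * Real.pi)⁻¹ * r, by positivity, ?_⟩
  rwa [fourierHat_eq, smul_smul] at h

/-- Every non-degenerate test function has a reconstruction wavelet in `𝓢₀(ℝⁿ)`. -/
theorem exists_reconstruction_wavelet {n : ℕ} {ψ : 𝓢(EuclideanSpace ℝ (Fin n), ℂ)}
    (hψ : NonDegenerate ψ) : ∃ η : testSpace n, ∀ ξ, ξ ≠ 0 →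
      ∫ y in Ioi (0 : ℝ), (y⁻¹ : ℂ) * (conj ((𝓕 ψ) (y • ξ)) * (𝓕 η.1) (y • ξ)) = 1 := by
  obtain ⟨θ, hθ0, hθ⟩ := exists_dual_multiplier (𝓕 ψ) hψ.exists_fourier_ne_zero
  refine ⟨⟨𝓕⁻ θ, fourierInv_mem_testSpace hθ0⟩, fun ξ hξ => ?_⟩
  rw [← hθ ξ hξ, FourierTransform.fourier_fourierInv_eq]

/-! ### Integration over the upper half-space -/

theorem measurableSet_upperHalfSpace (n : ℕ) : MeasurableSet (upperHalfSpace n) :=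
  measurableSet_lt measurable_const measurable_snd

theorem restrict_upperHalfSpace (n : ℕ) :
    (volume : Measure (EuclideanSpace ℝ (Fin n) × ℝ)).restrict (upperHalfSpace n) =
      volume.prod (volume.restrict (Ioi 0)) := by
  have h : upperHalfSpace n = univ ×ˢ Ioi (0 : ℝ) := by
    ext p
    simp [upperHalfSpace]
  rw [h, Measure.volume_eq_prod, ← Measure.prod_restrict, Measure.restrict_univ]

/-- The weight `(1 / y + y)⁻² (1 + |x|)⁻⁽ⁿ⁺¹⁾` is integrable over the upper half-space. -/
theorem integrableOn_weight (n : ℕ) :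
    IntegrableOn (fun p : EuclideanSpace ℝ (Fin n) × ℝ =>
      ((1 / p.2 + p.2) ^ 2)⁻¹ * ((1 + ‖p.1‖) ^ (n + 1))⁻¹) (upperHalfSpace n) := by
  have h1 : IntegrableOn (fun y : ℝ => ((1 / y + y) ^ 2)⁻¹) (Ioi 0) := by
    refine Integrable.mono' integrable_inv_one_add_sq.integrableOn
      (by fun_prop) ((ae_restrict_iff' measurableSet_Ioi).2 (.of_forall fun y hy => ?_))
    have hy' : (0 : ℝ) < y := hy
    rw [Real.norm_of_nonneg (by positivity)]
    gcongr
    have : 1 / y * y = 1 := one_div_mul_cancel hy'.ne'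
    nlinarith [sq_nonneg (1 / y)]
  rw [IntegrableOn, restrict_upperHalfSpace]
  refine ((integrable_inv_one_add_norm_pow n).mul_prod h1).congr (.of_forall fun p => ?_)
  exact mul_comm _ _

/-- A function with polynomial growth becomes integrable after multiplication by a sufficiently
decaying weight. -/
theorem integrableOn_of_norm_le {n : ℕ} {B : Type*} [NormedAddCommGroup B]
    {G : EuclideanSpace ℝ (Fin n) × ℝ → B} {C : ℝ}
    (hG : AEStronglyMeasurable G (volume.restrict (upperHalfSpace n)))
    (hb : ∀ p : EuclideanSpace ℝ (Fin n) × ℝ, 0 < p.2 →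
      ‖G p‖ ≤ C * (((1 / p.2 + p.2) ^ 2)⁻¹ * ((1 + ‖p.1‖) ^ (n + 1))⁻¹)) :
    IntegrableOn G (upperHalfSpace n) :=
  ((integrableOn_weight n).const_mul C).mono' hG
    ((ae_restrict_iff' (measurableSet_upperHalfSpace n)).2 (.of_forall hb))

theorem aestronglyMeasurable_apply_atomAt {n : ℕ} {B : Type*} [NormedAddCommGroup B]
    [NormedSpace ℂ B] (T : testSpace n →L[ℂ] B) (ψ : testSpace n) :
    AEStronglyMeasurable (fun p => T (atomAt ψ p)) (volume.restrict (upperHalfSpace n)) :=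
  (T.continuous.comp_continuousOn (continuousOn_atomAt ψ)).aestronglyMeasurable
    (measurableSet_upperHalfSpace n)

theorem measurable_inv_mul_kernel {n : ℕ} (φ η : 𝓢(EuclideanSpace ℝ (Fin n), ℂ)) :
    Measurable fun p : EuclideanSpace ℝ (Fin n) × ℝ => (p.2⁻¹ : ℂ) * kernel φ η p := by
  refine Measurable.mul ?_ (continuous_kernel φ η).measurable
  exact (Complex.measurable_ofReal.comp measurable_snd).inv

theorem norm_inv_mul_kernel {n : ℕ} (φ η : 𝓢(EuclideanSpace ℝ (Fin n), ℂ))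
    {p : EuclideanSpace ℝ (Fin n) × ℝ} (hp : 0 < p.2) :
    ‖(p.2⁻¹ : ℂ) * kernel φ η p‖ = p.2⁻¹ * ‖kernel φ η p‖ := by
  rw [norm_mul, norm_inv, Complex.norm_real, Real.norm_of_nonneg hp.le]

/-- The superposition of atoms with the kernel as coefficient converges absolutely in the Banach
space reached by any continuous linear map. -/
theorem integrableOn_kernel_smul_atomAt {n : ℕ} {B : Type*} [NormedAddCommGroup B]
    [NormedSpace ℂ B] (T : testSpace n →L[ℂ] B) (ψ φ η : testSpace n) :
    IntegrableOn (fun p => ((p.2⁻¹ : ℂ) * kernel φ.1 η.1 p) • T (atomAt ψ p))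
      (upperHalfSpace n) := by
  obtain ⟨C, a, b, hC0, hC⟩ := exists_norm_apply_atomAt_le T ψ
  obtain ⟨s, D, hD0, hD⟩ := exists_norm_kernel_le η (a + 2) (b + (n + 1))
  refine integrableOn_of_norm_le
    (C := D * (s.sup (schwartzSeminormFamily ℂ (EuclideanSpace ℝ (Fin n)) ℂ)) φ.1 * C)
    ((measurable_inv_mul_kernel φ.1 η.1).aestronglyMeasurable.smul
      (aestronglyMeasurable_apply_atomAt T ψ)) fun p hp => ?_
  have hy := one_le_inv_add hp
  rw [norm_smul, norm_inv_mul_kernel _ _ hp]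
  calc p.2⁻¹ * ‖kernel φ.1 η.1 p‖ * ‖T (atomAt ψ p)‖
      ≤ (D * (s.sup (schwartzSeminormFamily ℂ (EuclideanSpace ℝ (Fin n)) ℂ)) φ.1 *
          (((1 / p.2 + p.2) ^ (a + 2))⁻¹ * ((1 + ‖p.1‖) ^ (b + (n + 1)))⁻¹)) *
        (C * (1 / p.2 + p.2) ^ a * (1 + ‖p.1‖) ^ b) :=
        mul_le_mul (hD φ p hp) (hC p hp) (norm_nonneg _) (by positivity)
    _ = _ := by
        have h1 : (1 / p.2 + p.2) ≠ 0 := by positivity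
        have h2 : (1 + ‖p.1‖) ≠ 0 := by positivity
        generalize 1 / p.2 + p.2 = Y at *
        generalize 1 + ‖p.1‖ = Z at *
        rw [pow_add Y a 2, pow_add Z b (n + 1)]
        field_simp

/-! ### Fourier transforms of atoms and kernels -/

/-- The plane wave `exp (2 π i x · ξ)`. -/
def planeWave {n : ℕ} (x ξ : EuclideanSpace ℝ (Fin n)) : ℂ :=
  Complex.exp ((2 * Real.pi * inner ℝ x ξ : ℝ) * Complex.I)

theorem norm_planeWave {n : ℕ} (x ξ : EuclideanSpace ℝ (Fin n)) : ‖planeWave x ξ‖ = 1 :=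
  Complex.norm_exp_ofReal_mul_I _

theorem planeWave_add {n : ℕ} (x x' ξ : EuclideanSpace ℝ (Fin n)) :
    planeWave (x + x') ξ = planeWave x ξ * planeWave x' ξ := by
  rw [planeWave, planeWave, planeWave, ← Complex.exp_add, inner_add_left]
  push_cast
  ring_nf

theorem planeWave_smul {n : ℕ} (y : ℝ) (x ξ : EuclideanSpace ℝ (Fin n)) :
    planeWave (y • x) ξ = planeWave x (y • ξ) := by
  rw [planeWave, planeWave, inner_smul_left, inner_smul_right, conj_trivial]

theorem conj_planeWave {n : ℕ} (x ξ : EuclideanSpace ℝ (Fin n)) :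
    conj (planeWave x ξ) = planeWave (-x) ξ := by
  rw [planeWave, planeWave, ← Complex.exp_conj, inner_neg_left, map_mul, Complex.conj_I,
    Complex.conj_ofReal]
  congr 1
  push_cast
  ring

theorem planeWave_mul_neg {n : ℕ} (x ξ : EuclideanSpace ℝ (Fin n)) :
    planeWave x ξ * planeWave (-x) ξ = 1 := by
  rw [← planeWave_add, add_neg_cancel, planeWave, inner_zero_left]
  simp

theorem continuous_planeWave {n : ℕ} :
    Continuous fun z : EuclideanSpace ℝ (Fin n) × EuclideanSpace ℝ (Fin n) =>
      planeWave z.1 z.2 := by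
  unfold planeWave
  fun_prop

theorem fourierInv_apply {n : ℕ} (φ : 𝓢(EuclideanSpace ℝ (Fin n), ℂ))
    (ξ : EuclideanSpace ℝ (Fin n)) : (𝓕⁻ φ) ξ = ∫ t, planeWave t ξ * φ t := by
  rw [SchwartzMap.fourierInv_coe, Real.fourierInv_eq']
  rfl

theorem fourier_apply {n : ℕ} (φ : 𝓢(EuclideanSpace ℝ (Fin n), ℂ))
    (ξ : EuclideanSpace ℝ (Fin n)) : (𝓕 φ) ξ = ∫ t, planeWave (-t) ξ * φ t := by
  rw [SchwartzMap.fourier_coe, Real.fourier_eq']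
  refine integral_congr_ae (.of_forall fun t => ?_)
  simp only [planeWave, inner_neg_left, smul_eq_mul]
  congr 3
  push_cast
  ring

theorem fourierInv_atomSchwartz {n : ℕ} (ψ : 𝓢(EuclideanSpace ℝ (Fin n), ℂ))
    (x : EuclideanSpace ℝ (Fin n)) {y : ℝ} (hy : 0 < y) (ξ : EuclideanSpace ℝ (Fin n)) :
    (𝓕⁻ (atomSchwartz ψ x y hy)) ξ = planeWave x ξ * conj ((𝓕 ψ) (y • ξ)) := by
  rw [fourierInv_apply, fourier_apply, ← integral_conj, ← integral_const_mul,
    ← integral_add_left_eq_self _ x]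
  have h := Measure.integral_comp_smul volume
    (fun s => planeWave (x + s) ξ * ((((y ^ n)⁻¹ : ℝ) : ℂ) * conj (ψ (y⁻¹ • s)))) y
  rw [finrank_euclideanSpace_fin, abs_of_pos (by positivity)] at h
  have hy' : (y ^ n)⁻¹ ≠ 0 := by positivity
  rw [← smul_right_inj hy']
  calc _ = ∫ t, planeWave (x + y • t) ξ * ((((y ^ n)⁻¹ : ℝ) : ℂ) * conj (ψ (y⁻¹ • y • t))) := by
        rw [h]
        simp_rw [atomSchwartz_apply, add_sub_cancel_left]
    _ = _ := by
        rw [Complex.real_smul, ← integral_const_mul]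
        refine integral_congr_ae (.of_forall fun t => ?_)
        simp only [inv_smul_smul₀ hy.ne', planeWave_add, planeWave_smul, map_mul, conj_planeWave,
          neg_neg]
        ring

/-- In the space variable the kernel is a convolution, so its Fourier transform is a product. -/
theorem integral_planeWave_mul_kernel {n : ℕ} (φ η : 𝓢(EuclideanSpace ℝ (Fin n), ℂ)) (y : ℝ)
    (ξ : EuclideanSpace ℝ (Fin n)) :
    ∫ x, planeWave x ξ * kernel φ η (x, y) = (𝓕⁻ φ) ξ * (𝓕 η) (y • ξ) := by
  have hint : Integrable (Function.uncurry fun x t : EuclideanSpace ℝ (Fin n) =>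
      planeWave x ξ * (φ (x + y • t) * η t)) (volume.prod volume) := by
    have hm : AEStronglyMeasurable (Function.uncurry fun x t : EuclideanSpace ℝ (Fin n) =>
        planeWave x ξ * (φ (x + y • t) * η t)) (volume.prod volume) := by
      refine Continuous.aestronglyMeasurable ?_
      refine (continuous_planeWave.comp (continuous_fst.prodMk continuous_const)).mul
        (Continuous.mul (φ.continuous.comp (by fun_prop)) (η.continuous.comp continuous_snd))
    refine (integrable_prod_iff' hm).2 ⟨.of_forall fun t => ?_, ?_⟩
    · have h1 : Integrable fun x => φ (x + y • t) * η t :=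
        ((φ.integrable (μ := volume)).comp_add_right (y • t)).mul_const (η t)
      have h2 : Continuous fun x : EuclideanSpace ℝ (Fin n) => planeWave x ξ :=
        continuous_planeWave.comp (continuous_id.prodMk continuous_const)
      exact h1.bdd_mul (c := 1) h2.aestronglyMeasurable
        (.of_forall fun x => (norm_planeWave x ξ).le)
    · have h : ∀ t, ∫ x, ‖planeWave x ξ * (φ (x + y • t) * η t)‖ = (∫ x, ‖φ x‖) * ‖η t‖ := by
        intro t
        simp_rw [norm_mul, norm_planeWave, one_mul]
        rw [integral_mul_const, integral_add_right_eq_self (fun x => ‖φ x‖)]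
      simp only [Function.uncurry_apply_pair, h]
      exact η.integrable.norm.const_mul _
  calc ∫ x, planeWave x ξ * kernel φ η (x, y)
      = ∫ x, ∫ t, planeWave x ξ * (φ (x + y • t) * η t) := by
        simp_rw [kernel, integral_const_mul]
    _ = ∫ t, ∫ x, planeWave x ξ * (φ (x + y • t) * η t) := integral_integral_swap hint
    _ = ∫ t, (𝓕⁻ φ) ξ * (planeWave (-t) (y • ξ) * η t) := by
        refine integral_congr_ae (.of_forall fun t => ?_)
        change ∫ x, planeWave x ξ * (φ (x + y • t) * η t) =
          (𝓕⁻ φ) ξ * (planeWave (-t) (y • ξ) * η t)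
        rw [fourierInv_apply, ← integral_mul_const,
          ← integral_add_right_eq_self (fun x => planeWave x ξ * φ x * _) (y • t)]
        refine integral_congr_ae (.of_forall fun x => ?_)
        change planeWave x ξ * (φ (x + y • t) * η t) = planeWave (x + y • t) ξ * φ (x + y • t) *
          (planeWave (-t) (y • ξ) * η t)
        have := planeWave_mul_neg t (y • ξ)
        rw [planeWave_add, planeWave_smul]
        linear_combination (-(planeWave x ξ * φ (x + y • t) * η t)) * this
    _ = _ := by rw [integral_const_mul, fourier_apply]

theorem fourierInv_zero_of_mem_testSpace {n : ℕ} (φ : testSpace n) : (𝓕⁻ φ.1) 0 = 0 := by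
  have h := φ.2 0
  rw [fourierInv_apply]
  simpa [monomial, planeWave] using h

/-- The inverse Fourier transform of the reproducing formula: superposing the Fourier transforms of
the atoms with the synthesis kernel of `φ` recovers the Fourier transform of `φ`, pointwise. -/
theorem integral_kernel_mul_fourierInv_atom {n : ℕ} {ψ η : testSpace n}
    (hη : ∀ ξ, ξ ≠ 0 →
      ∫ y in Ioi (0 : ℝ), (y⁻¹ : ℂ) * (conj ((𝓕 ψ.1) (y • ξ)) * (𝓕 η.1) (y • ξ)) = 1)
    (φ : testSpace n) (ξ : EuclideanSpace ℝ (Fin n)) :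
    ∫ p in upperHalfSpace n, ((p.2⁻¹ : ℂ) * kernel φ.1 η.1 p) *
      (planeWave p.1 ξ * conj ((𝓕 ψ.1) (p.2 • ξ))) = (𝓕⁻ φ.1) ξ := by
  obtain ⟨s, D, hD0, hD⟩ := exists_norm_kernel_le η 2 (n + 1)
  have hint : IntegrableOn (fun p => ((p.2⁻¹ : ℂ) * kernel φ.1 η.1 p) *
      (planeWave p.1 ξ * conj ((𝓕 ψ.1) (p.2 • ξ)))) (upperHalfSpace n) := by
    refine integrableOn_of_norm_le
      (C := D * (s.sup (schwartzSeminormFamily ℂ (EuclideanSpace ℝ (Fin n)) ℂ)) φ.1 *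
        SchwartzMap.seminorm ℂ 0 0 (𝓕 ψ.1)) ?_ fun p hp => ?_
    · refine ((measurable_inv_mul_kernel φ.1 η.1).mul
        (Continuous.measurable ?_)).aestronglyMeasurable
      exact (continuous_planeWave.comp (continuous_fst.prodMk continuous_const)).mul
        (Complex.continuous_conj.comp ((𝓕 ψ.1).continuous.comp (by fun_prop)))
    · rw [norm_mul, norm_inv_mul_kernel _ _ hp, norm_mul, norm_planeWave, one_mul,
        RCLike.norm_conj]
      refine (mul_le_mul (hD φ p hp) (SchwartzMap.norm_le_seminorm ℂ _ _) (norm_nonneg _)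
        (by positivity)).trans_eq ?_
      ring
  rw [IntegrableOn, restrict_upperHalfSpace] at hint
  rw [restrict_upperHalfSpace, integral_prod_symm _ hint]
  have h1 : ∀ y : ℝ, ∫ x, ((y⁻¹ : ℂ) * kernel φ.1 η.1 (x, y)) *
      (planeWave x ξ * conj ((𝓕 ψ.1) (y • ξ))) =
      (𝓕⁻ φ.1) ξ * ((y⁻¹ : ℂ) * (conj ((𝓕 ψ.1) (y • ξ)) * (𝓕 η.1) (y • ξ))) := by
    intro y
    calc _ = ∫ x, ((y⁻¹ : ℂ) * conj ((𝓕 ψ.1) (y • ξ))) *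
          (planeWave x ξ * kernel φ.1 η.1 (x, y)) := by
          refine integral_congr_ae (.of_forall fun x => ?_)
          simp only
          ring
      _ = _ := by
          rw [integral_const_mul, integral_planeWave_mul_kernel]
          ring
  simp_rw [h1]
  rw [integral_const_mul]
  -- The origin is not a null set when `n = 0`, but there both sides vanish.
  by_cases hξ : ξ = 0
  · rw [hξ, fourierInv_zero_of_mem_testSpace, zero_mul]
  · rw [hη ξ hξ, mul_one]

/-! ### The reproducing formula -/

/-- A Schwartz function of `y • ξ` decays rapidly in `ξ`, with a loss that is polynomial in the
scale and the inverse scale. -/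
theorem exists_norm_apply_smul_le {n : ℕ} (Ψ : 𝓢(EuclideanSpace ℝ (Fin n), ℂ)) (r : ℕ) :
    ∃ C : ℝ, 0 ≤ C ∧ ∀ (ξ : EuclideanSpace ℝ (Fin n)) (y : ℝ), 0 < y →
      ‖Ψ (y • ξ)‖ ≤ C * (1 / y + y) ^ r * ((1 + ‖ξ‖) ^ r)⁻¹ := by
  refine ⟨decayBound r 0 Ψ, decayBound_nonneg _ _ _, fun ξ y hy => ?_⟩
  refine (norm_le_decayBound r Ψ (y • ξ)).trans ?_
  rw [mul_assoc]
  refine mul_le_mul_of_nonneg_left ?_ (decayBound_nonneg _ _ _)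
  rw [← div_eq_mul_inv, le_div_iff₀ (by positivity), inv_mul_le_iff₀ (by positivity), ← mul_pow]
  gcongr
  rw [norm_smul, Real.norm_of_nonneg hy.le]
  have h1 : 1 / y * y = 1 := one_div_mul_cancel hy.ne'
  have h2 := one_le_inv_add hy
  have h3 : (1 + y * ‖ξ‖) * (1 / y + y) = (1 / y + y) + (1 / y * y) * ‖ξ‖ + y * y * ‖ξ‖ := by ring
  rw [h3, h1]
  nlinarith [mul_nonneg (mul_nonneg hy.le hy.le) (norm_nonneg ξ)]

/-- The reproducing formula for functionals given on the Fourier side by integration against a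
function of polynomial growth. -/
theorem reproducing_of_fourierInv {n : ℕ} {ψ η : testSpace n}
    (hη : ∀ ξ, ξ ≠ 0 →
      ∫ y in Ioi (0 : ℝ), (y⁻¹ : ℂ) * (conj ((𝓕 ψ.1) (y • ξ)) * (𝓕 η.1) (y • ξ)) = 1)
    {h : EuclideanSpace ℝ (Fin n) → ℂ} (hc : Continuous h) {C : ℝ} {m : ℕ}
    (hC : ∀ ξ, ‖h ξ‖ ≤ C * (1 + ‖ξ‖) ^ m) (φ : testSpace n) :
    ∫ p in upperHalfSpace n, ((p.2⁻¹ : ℂ) * kernel φ.1 η.1 p) *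
      ∫ ξ, h ξ * (𝓕⁻ (atomAt ψ p).1) ξ = ∫ ξ, h ξ * (𝓕⁻ φ.1) ξ := by
  have hC0 : 0 ≤ C := by
    have := (norm_nonneg _).trans (hC 0)
    simpa using this
  let Z : EuclideanSpace ℝ (Fin n) × ℝ → EuclideanSpace ℝ (Fin n) → ℂ := fun p ξ =>
    h ξ * (((p.2⁻¹ : ℂ) * kernel φ.1 η.1 p) * (planeWave p.1 ξ * conj ((𝓕 ψ.1) (p.2 • ξ))))
  obtain ⟨D, hD0, hD⟩ := exists_norm_apply_smul_le (𝓕 ψ.1) (m + (n + 1))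
  obtain ⟨s, A, hA0, hA⟩ := exists_norm_kernel_le η (m + (n + 1) + 2) (n + 1)
  -- The rapid decay of the kernel in the scale pays for the loss of uniformity in `ψ̂ (y ξ)`.
  have hZ : Integrable (Function.uncurry Z)
      ((volume.restrict (upperHalfSpace n)).prod volume) := by
    have hmajor := ((integrableOn_weight n).const_mul
      (A * (s.sup (schwartzSeminormFamily ℂ (EuclideanSpace ℝ (Fin n)) ℂ)) φ.1)).mul_prod
      ((integrable_inv_one_add_norm_pow n).const_mul (C * D))
    refine hmajor.mono' ?_ ?_
    · refine Measurable.aestronglyMeasurable ?_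
      refine (hc.measurable.comp measurable_snd).mul
        (((measurable_inv_mul_kernel φ.1 η.1).comp measurable_fst).mul (Continuous.measurable ?_))
      exact (continuous_planeWave.comp (by fun_prop : Continuous
        fun z : (EuclideanSpace ℝ (Fin n) × ℝ) × EuclideanSpace ℝ (Fin n) => (z.1.1, z.2))).mul
          (Complex.continuous_conj.comp ((𝓕 ψ.1).continuous.comp (by fun_prop)))
    · have hae : ∀ᵐ z ∂((volume.restrict (upperHalfSpace n)).prod
          (volume : Measure (EuclideanSpace ℝ (Fin n)))), 0 < z.1.2 :=
        Measure.quasiMeasurePreserving_fst.ae (ae_restrict_mem (measurableSet_upperHalfSpace n))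
      filter_upwards [hae] with z hz
      obtain ⟨p, ξ⟩ := z
      change 0 < p.2 at hz
      change ‖Z p ξ‖ ≤ _
      have hy := one_le_inv_add hz
      simp only [Z]
      rw [norm_mul, norm_mul, norm_inv_mul_kernel _ _ hz, norm_mul, norm_planeWave, one_mul,
        RCLike.norm_conj]
      have hb := mul_le_mul (hC ξ) (mul_le_mul (hA φ p hz) (hD ξ p.2 hz) (norm_nonneg _)
        (by positivity)) (by positivity) (by positivity)
      refine hb.trans_eq ?_
      have h1 : (1 / p.2 + p.2) ≠ 0 := by positivity
      have h2 : (1 + ‖p.1‖) ≠ 0 := by positivity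
      have h3 : (1 + ‖ξ‖) ≠ 0 := by positivity
      generalize 1 / p.2 + p.2 = Y at *
      generalize 1 + ‖p.1‖ = X at *
      generalize 1 + ‖ξ‖ = U at *
      rw [pow_add Y (m + (n + 1)) 2, pow_add U m (n + 1)]
      field_simp
  have hleft : ∫ p in upperHalfSpace n, ((p.2⁻¹ : ℂ) * kernel φ.1 η.1 p) *
      ∫ ξ, h ξ * (𝓕⁻ (atomAt ψ p).1) ξ = ∫ p in upperHalfSpace n, ∫ ξ, Z p ξ := by
    refine setIntegral_congr_fun (measurableSet_upperHalfSpace n) fun p hp => ?_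
    have hp' : 0 < p.2 := hp
    rw [← integral_const_mul]
    refine integral_congr_ae (.of_forall fun ξ => ?_)
    simp only [Z, atomAt_of_pos ψ hp']
    change _ * (h ξ * (𝓕⁻ (atomSchwartz ψ.1 p.1 p.2 hp')) ξ) = _
    rw [fourierInv_atomSchwartz]
    ring
  rw [hleft, integral_integral_swap hZ]
  refine integral_congr_ae (.of_forall fun ξ => ?_)
  simp only [Z]
  rw [integral_const_mul, integral_kernel_mul_fourierInv_atom hη]

/-- By Fourier inversion the derivatives of a Schwartz function at a point are integrals of its
inverse Fourier transform against functions of polynomial growth. -/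
theorem exists_iteratedFDeriv_eq_integral {n : ℕ} (m : ℕ) (v : Fin m → EuclideanSpace ℝ (Fin n))
    (t : EuclideanSpace ℝ (Fin n)) :
    ∃ (h : EuclideanSpace ℝ (Fin n) → ℂ) (C : ℝ), Continuous h ∧
      (∀ ξ, ‖h ξ‖ ≤ C * (1 + ‖ξ‖) ^ m) ∧ ∀ φ : 𝓢(EuclideanSpace ℝ (Fin n), ℂ),
        iteratedFDeriv ℝ m φ t v = ∫ ξ, h ξ * (𝓕⁻ φ) ξ := by
  simp_rw [← SchwartzMap.iteratedLineDerivOp_eq_iteratedFDeriv]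
  induction m with
  | zero =>
    refine ⟨fun ξ => planeWave (-ξ) t, 1, ?_, fun ξ => by simp [norm_planeWave], fun φ => ?_⟩
    · have h1 : Continuous fun ξ : EuclideanSpace ℝ (Fin n) => (-ξ, t) := by fun_prop
      have h2 := (continuous_planeWave (n := n)).comp h1
      exact h2
    · have h2 := fourier_apply (𝓕⁻ φ) t
      rw [FourierTransform.fourier_fourierInv_eq] at h2
      rw [LineDeriv.iteratedLineDerivOp_fin_zero]
      exact h2
  | succ m ih =>
    obtain ⟨h, C, hc, hC, hh⟩ := ih (Fin.init v)
    refine ⟨fun ξ => h ξ * (-(2 * Real.pi * Complex.I) * (inner ℝ ξ (v (Fin.last m)) : ℝ)),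
      C * (2 * Real.pi * ‖v (Fin.last m)‖), ?_, fun ξ => ?_, fun φ => ?_⟩
    · exact hc.mul (continuous_const.mul (Complex.continuous_ofReal.comp (by fun_prop)))
    · have h1 : ‖-(2 * (Real.pi : ℂ) * Complex.I) * (inner ℝ ξ (v (Fin.last m)) : ℝ)‖ ≤
          2 * Real.pi * ‖v (Fin.last m)‖ * (1 + ‖ξ‖) := by
        rw [norm_mul, norm_neg, Complex.norm_real]
        simp only [norm_mul, Complex.norm_ofNat, Complex.norm_real, Complex.norm_I, mul_one,
          Real.norm_of_nonneg Real.pi_pos.le]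
        rw [mul_assoc (2 * Real.pi)]
        gcongr
        refine (norm_inner_le_norm _ _).trans ?_
        nlinarith [norm_nonneg ξ, norm_nonneg (v (Fin.last m))]
      have h2 := (norm_nonneg _).trans (hC ξ)
      rw [norm_mul]
      refine (mul_le_mul (hC ξ) h1 (norm_nonneg _) h2).trans_eq ?_
      rw [pow_succ]
      ring
    · have hg : (inner ℝ · (v (Fin.last m)) :
          EuclideanSpace ℝ (Fin n) → ℝ).HasTemperateGrowth := by fun_prop
      rw [LineDeriv.iteratedLineDerivOp_succ_right, hh, SchwartzMap.fourierInv_lineDerivOp_eq]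
      refine integral_congr_ae (.of_forall fun ξ => ?_)
      simp only [_root_.smul_apply, SchwartzMap.smulLeftCLM_apply_apply hg, smul_eq_mul,
        Complex.real_smul]
      ring

/-- Bounded continuous functions with values in the `m`-multilinear maps. -/
abbrev BoundedMultilinear (n m : ℕ) : Type :=
  EuclideanSpace ℝ (Fin n) →ᵇ (EuclideanSpace ℝ (Fin n)) [×m]→L[ℝ] ℂ

/-- The map `φ ↦ ‖t‖ ^ k • D ^ m φ t`, as a continuous linear map from the Schwartz space to the
bounded continuous functions. The norm of the image is the Schwartz seminorm with indices `k` and `m`. -/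
def weightedDeriv (n k m : ℕ) : 𝓢(EuclideanSpace ℝ (Fin n), ℂ) →L[ℂ] BoundedMultilinear n m :=
  SchwartzMap.mkCLMtoNormedSpace
    (fun φ => BoundedContinuousFunction.ofNormedAddCommGroup
      (fun t => ‖t‖ ^ k • iteratedFDeriv ℝ m φ t)
      ((continuous_norm.pow k).smul ((φ.smooth m).continuous_iteratedFDeriv'))
      (SchwartzMap.seminorm ℂ k m φ) fun t => by
        rw [norm_smul, norm_pow, norm_norm]
        exact SchwartzMap.le_seminorm ℂ k m φ t)
    (fun φ φ' => by
      ext1 t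
      change ‖t‖ ^ k • iteratedFDeriv ℝ m (φ + φ') t =
        ‖t‖ ^ k • iteratedFDeriv ℝ m φ t + ‖t‖ ^ k • iteratedFDeriv ℝ m φ' t
      rw [← smul_add]
      congr 1
      exact iteratedFDeriv_add_apply (φ.contDiffAt m) (φ'.contDiffAt m))
    (fun a φ => by
      ext1 t
      change ‖t‖ ^ k • iteratedFDeriv ℝ m (a • φ) t = a • ‖t‖ ^ k • iteratedFDeriv ℝ m φ t
      rw [smul_comm]
      congr 1
      exact iteratedFDeriv_const_smul_apply (φ.contDiffAt m))
    ⟨{(k, m)}, 1, zero_le_one, fun φ => by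
      rw [Finset.sup_singleton, one_mul]
      refine BoundedContinuousFunction.norm_ofNormedAddCommGroup_le _ (by positivity) _⟩

theorem weightedDeriv_apply {n : ℕ} (k m : ℕ) (φ : 𝓢(EuclideanSpace ℝ (Fin n), ℂ))
    (t : EuclideanSpace ℝ (Fin n)) :
    weightedDeriv n k m φ t = ‖t‖ ^ k • iteratedFDeriv ℝ m φ t := rfl

theorem seminorm_le_norm_weightedDeriv {n : ℕ} (k m : ℕ) (φ : 𝓢(EuclideanSpace ℝ (Fin n), ℂ)) :
    SchwartzMap.seminorm ℂ k m φ ≤ ‖weightedDeriv n k m φ‖ := by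
  refine SchwartzMap.seminorm_le_bound ℂ k m φ (norm_nonneg (weightedDeriv n k m φ)) fun t => ?_
  have := (weightedDeriv n k m φ).norm_coe_le_norm t
  rwa [weightedDeriv_apply, norm_smul, norm_pow, norm_norm] at this

/-- The reproducing formula for the weighted derivatives, as an identity of Bochner integrals. -/
theorem integral_kernel_smul_weightedDeriv {n : ℕ} {ψ η : testSpace n}
    (hη : ∀ ξ, ξ ≠ 0 →
      ∫ y in Ioi (0 : ℝ), (y⁻¹ : ℂ) * (conj ((𝓕 ψ.1) (y • ξ)) * (𝓕 η.1) (y • ξ)) = 1)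
    (k m : ℕ) (φ : testSpace n) :
    ∫ p in upperHalfSpace n, ((p.2⁻¹ : ℂ) * kernel φ.1 η.1 p) •
      weightedDeriv n k m (atomAt ψ p).1 = weightedDeriv n k m φ.1 := by
  have hint := integrableOn_kernel_smul_atomAt (B := BoundedMultilinear n m)
    ((weightedDeriv n k m).comp (testSpace n).subtypeL) ψ φ η
  ext t v
  let ev : BoundedMultilinear n m →L[ℝ] ℂ :=
    (ContinuousMultilinearMap.apply ℝ (fun _ : Fin m => EuclideanSpace ℝ (Fin n)) ℂ v).comp
      (BoundedContinuousFunction.evalCLM ℝ t)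
  obtain ⟨h, C, hc, hC, hh⟩ := exists_iteratedFDeriv_eq_integral m v t
  have hev : ∀ φ' : 𝓢(EuclideanSpace ℝ (Fin n), ℂ), ev (weightedDeriv n k m φ') =
      ((‖t‖ ^ k : ℝ) : ℂ) * ∫ ξ, h ξ * (𝓕⁻ φ') ξ := by
    intro φ'
    rw [← hh, ← Complex.real_smul]
    rfl
  refine (ContinuousLinearMap.integral_comp_comm (𝕜 := ℝ) (E := BoundedMultilinear n m)
    ev hint).symm.trans ?_
  change _ = ev (weightedDeriv n k m φ.1)
  rw [hev, ← reproducing_of_fourierInv hη hc hC, ← integral_const_mul]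
  refine integral_congr_ae (.of_forall fun p => ?_)
  have hsm : ∀ (c : ℂ) (F : BoundedMultilinear n m), ev (c • F) = c * ev F := fun _ _ => rfl
  change ev (_ • weightedDeriv n k m (atomAt ψ p).1) = _
  rw [hsm, hev]
  ring

/-- A functional dominated by the norm of `J` factors through `J`, by the Hahn–Banach theorem. -/
theorem exists_dual_factorization {S B : Type*} [AddCommGroup S] [Module ℂ S]
    [NormedAddCommGroup B] [NormedSpace ℂ B] (J : S →ₗ[ℂ] B) (u : S →ₗ[ℂ] ℂ) {C : ℝ}
    (h : ∀ φ, ‖u φ‖ ≤ C * ‖J φ‖) : ∃ w : B →L[ℂ] ℂ, ∀ φ, w (J φ) = u φ := by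
  obtain ⟨g, hg⟩ := J.rangeRestrict.exists_rightInverse_of_surjective J.range_rangeRestrict
  have hg' : ∀ z, J (g z) = z := fun z => congrArg Subtype.val (LinearMap.congr_fun hg z)
  let w₀ : LinearMap.range J →L[ℂ] ℂ := (u ∘ₗ g).mkContinuous C fun z => by
    have := h (g z)
    rwa [hg'] at this
  obtain ⟨w, hw, -⟩ := exists_extension_norm_eq _ w₀
  refine ⟨w, fun φ => ?_⟩
  have h1 := hw (J.rangeRestrict φ)
  have h2 := h (g (J.rangeRestrict φ) - φ)
  have h3 : J (g (J.rangeRestrict φ)) = J φ := hg' _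
  rw [map_sub, map_sub, h3, sub_self, norm_zero, mul_zero,
    norm_le_zero_iff, sub_eq_zero] at h2
  rw [← h2]
  exact h1

/-- The reproducing formula for continuous functionals. -/
theorem reproducing_formula {n : ℕ} {ψ η : testSpace n}
    (hη : ∀ ξ, ξ ≠ 0 →
      ∫ y in Ioi (0 : ℝ), (y⁻¹ : ℂ) * (conj ((𝓕 ψ.1) (y • ξ)) * (𝓕 η.1) (y • ξ)) = 1)
    (u : testSpace n →L[ℂ] ℂ) (φ : testSpace n) :
    ∫ p in upperHalfSpace n, ((p.2⁻¹ : ℂ) * kernel φ.1 η.1 p) * u (atomAt ψ p) = u φ := by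
  obtain ⟨s, C, hC0, hC⟩ := exists_bound_of_distribution u
  let J : testSpace n →L[ℂ] ((i : s) → BoundedMultilinear n i.1.2) :=
    ContinuousLinearMap.pi fun i => (weightedDeriv n i.1.1 i.1.2).comp (testSpace n).subtypeL
  have hJ : ∀ φ, ‖u φ‖ ≤ C * ‖J φ‖ := by
    intro φ
    refine (hC φ).trans (mul_le_mul_of_nonneg_left ?_ hC0)
    refine Seminorm.finset_sup_apply_le (norm_nonneg _) fun i hi => ?_
    exact (seminorm_le_norm_weightedDeriv i.1 i.2 φ.1).trans (norm_le_pi_norm (J φ) ⟨i, hi⟩)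
  obtain ⟨w, hw⟩ := exists_dual_factorization (S := testSpace n)
    (B := (i : s) → BoundedMultilinear n i.1.2) (C := C) J.toLinearMap u.toLinearMap hJ
  have hint := integrableOn_kernel_smul_atomAt (B := (i : s) → BoundedMultilinear n i.1.2) J ψ φ η
  have hΦ : ∫ p in upperHalfSpace n, ((p.2⁻¹ : ℂ) * kernel φ.1 η.1 p) • J (atomAt ψ p) = J φ := by
    funext i
    have h1 := ContinuousLinearMap.integral_comp_comm (𝕜 := ℂ)
      (E := (i : s) → BoundedMultilinear n i.1.2) (Fₗ := BoundedMultilinear n i.1.2)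
      (ContinuousLinearMap.proj (R := ℂ) (φ := fun i : s => BoundedMultilinear n i.1.2) i) hint
    exact h1.symm.trans (integral_kernel_smul_weightedDeriv hη i.1.1 i.1.2 φ)
  have h2 := w.integral_comp_comm hint
  rw [hΦ] at h2
  refine Eq.trans (integral_congr_ae (.of_forall fun p => ?_)) (h2.trans (hw φ))
  simp only [map_smul, smul_eq_mul]
  congr 1
  exact (hw _).symm

/-! ### The wavelet transform of a Banach-valued distribution -/

/-- The wavelet transform of a Banach-valued distribution is measurable, and integrable against a
sufficiently decaying weight. -/
theorem exists_integrableOn_waveletTransform {n : ℕ} {E : Type*} [NormedAddCommGroup E]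
    [NormedSpace ℂ E] (ψ : testSpace n) (g : Distribution n E) :
    ∃ k l : ℕ, IntegrableOn (fun p : EuclideanSpace ℝ (Fin n) × ℝ =>
      (1 / p.2 + p.2) ^ (-(k : ℤ)) * (1 + ‖p.1‖) ^ (-(l : ℤ)) * ‖g (atomAt ψ p)‖)
      (upperHalfSpace n) := by
  obtain ⟨C, a, b, hC0, hC⟩ := exists_norm_apply_atomAt_le g ψ
  refine ⟨a + 2, b + (n + 1), integrableOn_of_norm_le (C := C) ?_ fun p hp => ?_⟩
  · have h : Measurable fun p : EuclideanSpace ℝ (Fin n) × ℝ =>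
        (1 / p.2 + p.2) ^ (-((a + 2 : ℕ) : ℤ)) * (1 + ‖p.1‖) ^ (-((b + (n + 1) : ℕ) : ℤ)) := by
      simp only [zpow_neg, zpow_natCast]
      fun_prop
    exact h.aestronglyMeasurable.mul (aestronglyMeasurable_apply_atomAt g ψ).norm
  · have hy := one_le_inv_add hp
    rw [Real.norm_of_nonneg (by positivity), zpow_neg, zpow_neg, zpow_natCast, zpow_natCast]
    refine (mul_le_mul_of_nonneg_left (hC p hp) (by positivity)).trans_eq ?_
    have h1 : (1 / p.2 + p.2) ≠ 0 := by positivity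
    have h2 : (1 + ‖p.1‖) ≠ 0 := by positivity
    generalize 1 / p.2 + p.2 = Y at *
    generalize 1 + ‖p.1‖ = Z at *
    rw [pow_add Y a 2, pow_add Z b (n + 1)]
    field_simp

/-! ### Synthesis of a distribution from its wavelet transform -/

theorem kernel_add {n : ℕ} (φ φ' η : 𝓢(EuclideanSpace ℝ (Fin n), ℂ))
    (p : EuclideanSpace ℝ (Fin n) × ℝ) :
    kernel (φ + φ') η p = kernel φ η p + kernel φ' η p := by
  rw [kernel, kernel, kernel, ← integral_add (integrable_kernel_integrand φ η p)
    (integrable_kernel_integrand φ' η p)]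
  simp only [_root_.add_apply, add_mul]

theorem kernel_smul {n : ℕ} (c : ℂ) (φ η : 𝓢(EuclideanSpace ℝ (Fin n), ℂ))
    (p : EuclideanSpace ℝ (Fin n) × ℝ) : kernel (c • φ) η p = c * kernel φ η p := by
  rw [kernel, kernel, ← integral_const_mul]
  simp only [_root_.smul_apply, smul_eq_mul, mul_assoc]

/-- A weighted integrable function on the upper half-space synthesises a Banach-valued distribution
by integration against the kernel. -/
theorem exists_synthesis {n : ℕ} {E : Type*} [NormedAddCommGroup E] [NormedSpace ℂ E]
    (η : testSpace n) {F : EuclideanSpace ℝ (Fin n) × ℝ → E}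
    (hF : AEStronglyMeasurable F (volume.restrict (upperHalfSpace n))) {k l : ℕ}
    (hkl : IntegrableOn (fun p : EuclideanSpace ℝ (Fin n) × ℝ =>
      (1 / p.2 + p.2) ^ (-(k : ℤ)) * (1 + ‖p.1‖) ^ (-(l : ℤ)) * ‖F p‖) (upperHalfSpace n)) :
    ∃ g : Distribution n E, ∀ φ : testSpace n,
      IntegrableOn (fun p => ((p.2⁻¹ : ℂ) * kernel φ.1 η.1 p) • F p) (upperHalfSpace n) ∧
      g φ = ∫ p in upperHalfSpace n, ((p.2⁻¹ : ℂ) * kernel φ.1 η.1 p) • F p := by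
  obtain ⟨s, D, hD0, hD⟩ := exists_norm_kernel_le η k l
  simp only [zpow_neg, zpow_natCast] at hkl
  have hbound : ∀ φ : testSpace n, ∀ᵐ p ∂(volume.restrict (upperHalfSpace n)),
      ‖((p.2⁻¹ : ℂ) * kernel φ.1 η.1 p) • F p‖ ≤
        D * (s.sup (schwartzSeminormFamily ℂ (EuclideanSpace ℝ (Fin n)) ℂ)) φ.1 *
          (((1 / p.2 + p.2) ^ k)⁻¹ * ((1 + ‖p.1‖) ^ l)⁻¹ * ‖F p‖) := by
    intro φ
    refine (ae_restrict_iff' (measurableSet_upperHalfSpace n)).2 (.of_forall fun p hp => ?_)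
    rw [norm_smul, norm_inv_mul_kernel _ _ hp, ← mul_assoc]
    exact mul_le_mul_of_nonneg_right (hD φ p hp) (norm_nonneg _)
  have hint : ∀ φ : testSpace n,
      IntegrableOn (fun p => ((p.2⁻¹ : ℂ) * kernel φ.1 η.1 p) • F p) (upperHalfSpace n) := fun φ =>
    (hkl.const_mul _).mono' ((measurable_inv_mul_kernel φ.1 η.1).aestronglyMeasurable.smul hF)
      (hbound φ)
  let G : testSpace n →ₗ[ℂ] E :=
    { toFun := fun φ => ∫ p in upperHalfSpace n, ((p.2⁻¹ : ℂ) * kernel φ.1 η.1 p) • F p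
      map_add' := fun φ φ' => by
        rw [← integral_add (hint φ) (hint φ')]
        simp only [Submodule.coe_add, kernel_add, mul_add, add_smul]
      map_smul' := fun c φ => by
        rw [RingHom.id_apply, ← integral_smul]
        simp only [Submodule.coe_smul, kernel_smul, smul_smul, mul_left_comm] }
  refine ⟨⟨G, ?_⟩, fun φ => ⟨hint φ, rfl⟩⟩
  set I := ∫ p in upperHalfSpace n, ((1 / p.2 + p.2) ^ k)⁻¹ * ((1 + ‖p.1‖) ^ l)⁻¹ * ‖F p‖ with hI
  have hI0 : 0 ≤ I := setIntegral_nonneg (measurableSet_upperHalfSpace n) fun p hp => by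
    have : 0 < p.2 := hp
    positivity
  refine WithSeminorms.continuous_normedSpace_rng E (withSeminorms_testSpace n) G
    ⟨s, ⟨D * I, mul_nonneg hD0 hI0⟩, fun φ => ?_⟩
  rw [← SeminormFamily.finset_sup_comp]
  change ‖∫ p in upperHalfSpace n, ((p.2⁻¹ : ℂ) * kernel φ.1 η.1 p) • F p‖ ≤
    D * I * (s.sup (schwartzSeminormFamily ℂ (EuclideanSpace ℝ (Fin n)) ℂ)) φ.1
  refine (norm_integral_le_of_norm_le (hkl.const_mul _) (hbound φ)).trans_eq ?_
  rw [integral_const_mul, mul_right_comm]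

/-- Continuous complex functionals separate the points of a Hausdorff locally convex space. -/
theorem eq_of_forall_dual_eq {X : Type*} [AddCommGroup X] [Module ℂ X] [TopologicalSpace X]
    [IsTopologicalAddGroup X] [ContinuousSMul ℂ X] [LocallyConvexSpace ℝ X] [T2Space X] {x y : X}
    (h : ∀ L : X →L[ℂ] ℂ, L x = L y) : x = y := by
  by_contra hxy
  have : ContinuousSMul ℝ X := IsScalarTower.continuousSMul ℂ
  obtain ⟨L, hL⟩ := RCLike.geometric_hahn_banach_point_point (𝕜 := ℂ) hxy
  rw [h L] at hL
  exact lt_irrefl _ hL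

end Lizorkin

end
theorem mainTheorem2 {n : ℕ} {E X : Type*}
    [NormedAddCommGroup E] [NormedSpace ℂ E] [CompleteSpace E]
    [AddCommGroup X] [Module ℂ X] [TopologicalSpace X] [IsTopologicalAddGroup X]
    [ContinuousSMul ℂ X] [LocallyConvexSpace ℝ X] [T2Space X]
    (ι : E →L[ℂ] X) (hι : Function.Injective ι)
    (f : Lizorkin.Distribution n X) (ψ : Lizorkin.testSpace n)
    (hψ : Lizorkin.NonDegenerate (ψ : 𝓢(EuclideanSpace ℝ (Fin n), ℂ))) :
    (∃ g : Lizorkin.Distribution n E, ι.comp g = f) ↔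
      ∃ F : EuclideanSpace ℝ (Fin n) × ℝ → E,
        (∀ᵐ p ∂(volume.restrict (Lizorkin.upperHalfSpace n)),
          ι (F p) = Lizorkin.waveletTransform ψ f p) ∧
        AEStronglyMeasurable F
          (volume.restrict (Lizorkin.upperHalfSpace n)) ∧
        ∃ k l : ℕ, IntegrableOn
          (fun p : EuclideanSpace ℝ (Fin n) × ℝ =>
            (1 / p.2 + p.2) ^ (-(k : ℤ)) * (1 + ‖p.1‖) ^ (-(l : ℤ)) * ‖F p‖)
          (Lizorkin.upperHalfSpace n) volume := by
  constructor
  · rintro ⟨g, rfl⟩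
    refine ⟨fun p => g (Lizorkin.atomAt ψ p), .of_forall fun p => ?_,
      Lizorkin.aestronglyMeasurable_apply_atomAt g ψ,
      Lizorkin.exists_integrableOn_waveletTransform ψ g⟩
    rw [Lizorkin.waveletTransform_eq, ContinuousLinearMap.comp_apply]
  · rintro ⟨F, hWF, hF, k, l, hkl⟩
    obtain ⟨η, hη⟩ := Lizorkin.exists_reconstruction_wavelet hψ
    obtain ⟨g, hg⟩ := Lizorkin.exists_synthesis η hF hkl
    refine ⟨g, ContinuousLinearMap.ext fun φ => Lizorkin.eq_of_forall_dual_eq fun L => ?_⟩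
    change L (ι (g φ)) = L (f φ)
    -- `X` need not be complete: the integral is taken in `E`, and only scalars leave it.
    have h1 := (L.comp ι).integral_comp_comm (hg φ).1
    rw [← (hg φ).2, ContinuousLinearMap.comp_apply] at h1
    rw [← h1, ← ContinuousLinearMap.comp_apply L f,
      ← Lizorkin.reproducing_formula hη (L.comp f) φ]
    refine integral_congr_ae ?_
    filter_upwards [hWF] with p hp
    rw [map_smul, smul_eq_mul, ContinuousLinearMap.comp_apply, hp, Lizorkin.waveletTransform_eq,
      ContinuousLinearMap.comp_apply]
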